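/- Definitions. Let $\mathcal L$ be the family of discrete sets $L\subset\mathbb R$ (finitely many points in every bounded interval), unbounded from above and from below, such that, as $x\to\infty$, $\operatorname{Card}(L\cap[0,x])=O(x)$ and $\operatorname{Card}(L\cap[0,x+a])-\operatorname{Card}(L\cap[-x+b,0])=O(x/\log^2x)$ for all $a,b\in\mathbb R$. Let $\mathcal A$ be the $\sigma$-algebra on $\mathcal L$ generated by the maps $L\mapsto\operatorname{Card}(L\cap I)$, $I$ a bounded open interval. Let $\Gamma$ be the set of sequences $(\gamma_j)_{j\in\mathbb Z}$ of positive reals for which there is $c>0$ with $\sum_{j=0}^k\gamma_j=ck+O(k/\log^2k)$ and $\sum_{j=0}^k\gamma_{-j}=ck+O(k/\log^2k)$ as $k\to\infty$, with the $\sigma$-algebra $\mathcal C$ generated by the coordinates. For $L\in\mathcal L$ let $(\lambda_j)_{j\in\mathbb Z}$ be its unique increasing labeling with $\lambda_{-1}<0\le\lambda_0$, and for $\gamma\in\Gamma$, $h\in\mathbb R$ let $$\mathcal D(L,\gamma,h)=\{z\notin L:\ S_\Lambda(z)=h\},\qquad S_\Lambda(z)=\lim_{c\to\infty}\sum_{j:\,|\lambda_j|\le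 c}\frac{\gamma_j}{\lambda_j-z},\qquad \Lambda=\sum_{j\in\mathbb Z}\gamma_j\delta_{\lambda_j}$$ (this level set consists of real points and belongs to $\mathcal L$). For a probability measure $\Pi$ on $(\Gamma\times\mathbb R,\mathcal C\otimes\mathcal B(\mathbb R))$, the Stieltjes Markov chain associated to $\Pi$ is the chain on $\mathcal L$ given by $X_{k+1}=\mathcal D(X_k,G_k)$, with $G_k$ a fresh sample of $\Pi$. A probability measure $\mathbb Q$ on $(\mathcal L,\mathcal A)$ is invariant for it if $\mathcal D(L,\gamma,h)$ has law $\mathbb Q$ under $\mathbb Q\otimes\Pi$. For a probability measure $\sigma$ on the unit circle $\mathbb U$ supported on $n$ points, the Verblunsky coefficients are $\alpha_k=-\overline{\Phi_{k+1}(0)}$, $0\le k\le n-1$, where $\Phi_k$ is the monic polynomial of degree $k$ orthogonal to $1,z,\dots,z^{k-1}$ in $L^2(\sigma)$. Theorem. Let $n\ge1$ be an integer, and let $\Pi$ be a probability measure on $(\Gamma\times\mathbb R,\mathcal C\otimes\mathcal B(\mathbb R))$ such that: 1. $\Pi$-almost surely, $(\gamma_j)_{j\in\mathbb Z}$ is $n$-periodic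 and $\sum_{j=0}^{n-1}\gamma_j=2n$; 2. the law of $(\gamma_0,\dots,\gamma_{n-1})$ is invariant under permutations of the coordinates; 3. the sequence $(\gamma_j)_{j\in\mathbb Z}$ is independent of $h$. Let $\mathbb Q$ be a probability measure on $(\mathcal L,\mathcal A)$ under which, almost surely, $L$ is $2\pi n$-periodic and contains exactly $n$ points in $[0,2\pi n)$. Then, almost surely, the points $u_j=e^{i\lambda_{j-1}/n}$, $1\le j\le n$, of $\mathbb U$ have increasing arguments in $[0,2\pi)$ and $L=\{z\in\mathbb R:\ e^{iz/n}\in\{u_1,\dots,u_n\}\}$; and under $\mathbb Q\otimes\Pi$, $$\sigma=\frac1{2n}\sum_{j=1}^n\gamma_j\,\delta_{u_j}$$ is almost surely a probability measure on $\mathbb U$. If, moreover, the joint law under $\mathbb Q\otimes\Pi$ of the Verblunsky coefficients $(\alpha_0,\dots,\alpha_{n-1})$ of $\sigma$ is invariant under rotation, i.e. $(\alpha_0u,\dots,\alpha_{n-1}u)$ has the same law as $(\alpha_0,\dots,\alpha_{n-1})$ for every $u\in\mathbb U$, then $\mathbb Q$ is an invariant measure for the Stieltjes Markov chain associated to $\Pi$.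 -/

import Mathlib

open MeasureTheory ProbabilityTheory Filter Topology Set Asymptotics
open scoped ComplexConjugate

noncomputable section

namespace StieltjesChain

/-- A discrete set of real points, unbounded in both directions, whose counting function satisfies
`Card (L ∩ [0, x]) = O(x)` and `Card (L ∩ [0, x + a]) - Card (L ∩ [-x + b, 0]) = O(x / log² x)`
as `x → ∞`, for all real `a`, `b`. (The counting conditions presuppose that bounded windows contain
finitely many points, which is recorded in `finite_inter_Icc` and is what discreteness means.) -/
structure IsPointSet (L : Set ℝ) : Prop where
  finite_inter_Icc : ∀ a b : ℝ, (L ∩ Icc a b).Finite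
  not_bddAbove : ¬ BddAbove L
  not_bddBelow : ¬ BddBelow L
  card_isBigO :
    (fun x : ℝ => ((L ∩ Icc 0 x).ncard : ℝ)) =O[atTop] (fun x : ℝ => x)
  card_sub_card_isBigO : ∀ a b : ℝ,
    (fun x : ℝ => ((L ∩ Icc 0 (x + a)).ncard : ℝ) - ((L ∩ Icc (-x + b) 0).ncard : ℝ))
      =O[atTop] (fun x : ℝ => x / Real.log x ^ 2)

/-- The state space `𝓛` of the chain. -/
structure PointSet where
  carrier : Set ℝ
  isPointSet : IsPointSet carrier

/-- The σ-algebra `𝒜` on `𝓛`, generated by `L ↦ Card (L ∩ I)` for bounded open intervals `I`. -/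
instance : MeasurableSpace PointSet :=
  ⨆ (a : ℝ) (b : ℝ),
    MeasurableSpace.comap (fun L : PointSet => (L.carrier ∩ Ioo a b).ncard) inferInstance

/-- Positive weight sequences with `∑_{j=0}^k γ_j = ck + O(k / log² k)` and
`∑_{j=0}^k γ_{-j} = ck + O(k / log² k)` for some `c > 0`. -/
def IsWeight (γ : ℤ → ℝ) : Prop :=
  (∀ j, 0 < γ j) ∧
  ∃ c : ℝ, 0 < c ∧
    ((fun k : ℕ => (∑ j ∈ Finset.range (k + 1), γ (j : ℤ)) - c * k)
      =O[atTop] (fun k : ℕ => (k : ℝ) / Real.log k ^ 2)) ∧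
    ((fun k : ℕ => (∑ j ∈ Finset.range (k + 1), γ (-(j : ℤ))) - c * k)
      =O[atTop] (fun k : ℕ => (k : ℝ) / Real.log k ^ 2))

/-- The space `Γ` of weights. As a subtype of `ℤ → ℝ` it carries the σ-algebra generated by the
coordinates. -/
abbrev Weights : Type := {γ : ℤ → ℝ // IsWeight γ}

/-- `l` is an increasing enumeration of `L` by `ℤ` with `l (-1) < 0 ≤ l 0`. -/
structure IsLabeling (L : Set ℝ) (l : ℤ → ℝ) : Prop where
  strictMono : StrictMono l
  range_eq : range l = L
  neg_one_neg : l (-1) < 0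
  zero_nonneg : 0 ≤ l 0

theorem exists_isLabeling (L : PointSet) : ∃ l : ℤ → ℝ, IsLabeling L.carrier l := by
  classical
  obtain ⟨S, hS⟩ := L
  show ∃ l : ℤ → ℝ, IsLabeling S l
  have hfin : ∀ a b : S, (Icc a b).Finite := by
    intro a b
    refine Finite.of_finite_image (f := Subtype.val) ((hS.finite_inter_Icc a b).subset ?_)
      Subtype.val_injective.injOn
    rintro _ ⟨x, hx, rfl⟩
    exact ⟨x.2, hx⟩
  let _ : LocallyFiniteOrder S := LocallyFiniteOrder.ofFiniteIcc hfin
  have hab : ∀ r : ℝ, ∃ x ∈ S, r < x := by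
    intro r
    by_contra! H
    exact hS.not_bddAbove ⟨r, fun x hx => H x hx⟩
  have hbe : ∀ r : ℝ, ∃ x ∈ S, x < r := by
    intro r
    by_contra! H
    exact hS.not_bddBelow ⟨r, fun x hx => H x hx⟩
  have _ : NoMaxOrder S := ⟨fun a => by
    obtain ⟨x, hx, h⟩ := hab a
    exact ⟨⟨x, hx⟩, h⟩⟩
  have _ : NoMinOrder S := ⟨fun a => by
    obtain ⟨x, hx, h⟩ := hbe a
    exact ⟨⟨x, hx⟩, h⟩⟩
  have _ : Nonempty S := by
    obtain ⟨x, hx, -⟩ := hab 0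
    exact ⟨⟨x, hx⟩⟩
  let _ : SuccOrder S := LinearLocallyFiniteOrder.succOrder S
  let _ : PredOrder S := LinearLocallyFiniteOrder.predOrder S
  let e : S ≃o ℤ := orderIsoIntOfLinearSuccPredArch
  obtain ⟨y, hy, hy0⟩ := hbe 0
  obtain ⟨x, hx, hx0⟩ := hab 0
  obtain ⟨m, hm, hmin⟩ := Int.exists_least_of_bdd (P := fun j => (0 : ℝ) ≤ (e.symm j : ℝ))
    ⟨e ⟨y, hy⟩, fun z hz => by
      by_contra! H
      have h1 : e.symm z ≤ ⟨y, hy⟩ := by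
        rw [← e.symm_apply_apply ⟨y, hy⟩]
        exact e.symm.monotone H.le
      have h2 : (e.symm z : ℝ) ≤ y := h1
      linarith⟩
    ⟨e ⟨x, hx⟩, by simpa using hx0.le⟩
  refine ⟨fun j => (e.symm (j + m) : ℝ), ?_, ?_, ?_, ?_⟩
  · intro i j hij
    exact e.symm.strictMono (by omega)
  · ext z
    constructor
    · rintro ⟨j, rfl⟩
      exact (e.symm (j + m)).2
    · intro hz
      refine ⟨e ⟨z, hz⟩ - m, ?_⟩
      simp
  · by_contra! H
    have := hmin _ H
    omega
  · simpa using hm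

theorem IsLabeling.unique {L : Set ℝ} {l l' : ℤ → ℝ} (h : IsLabeling L l) (h' : IsLabeling L l') :
    l = l' := by
  have hn : ∀ {f : ℤ → ℝ}, IsLabeling L f → ∀ j : ℤ, 0 ≤ f j ↔ 0 ≤ j := by
    intro f hf j
    constructor
    · intro hj
      by_contra! H
      have := hf.strictMono.monotone (show j ≤ -1 by omega)
      linarith [hf.neg_one_neg]
    · intro hj
      exact hf.zero_nonneg.trans (hf.strictMono.monotone hj)
  have hp : ∀ {f : ℤ → ℝ}, IsLabeling L f → range (fun k : ℕ => f k) = L ∩ Ici 0 := by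
    intro f hf
    ext z
    constructor
    · rintro ⟨k, rfl⟩
      exact ⟨hf.range_eq ▸ mem_range_self _, (hn hf _).2 (by positivity)⟩
    · rintro ⟨hz, hz0⟩
      rw [← hf.range_eq] at hz
      obtain ⟨j, rfl⟩ := hz
      have := (hn hf j).1 hz0
      exact ⟨j.toNat, by simp [this]⟩
  have hq : ∀ {f : ℤ → ℝ}, IsLabeling L f →
      range (fun k : ℕ => -f (-1 - k)) = (fun z => -z) '' (L ∩ Iio 0) := by
    intro f hf
    ext z
    constructor
    · rintro ⟨k, rfl⟩
      refine ⟨f (-1 - k), ⟨hf.range_eq ▸ mem_range_self _, ?_⟩, rfl⟩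
      by_contra! H
      have := (hn hf (-1 - k)).1 (by simpa using H)
      omega
    · rintro ⟨w, ⟨hw, hw0⟩, rfl⟩
      rw [← hf.range_eq] at hw
      obtain ⟨j, rfl⟩ := hw
      have : j < 0 := by
        by_contra! H
        exact absurd ((hn hf j).2 H) (not_le.2 hw0)
      refine ⟨(-1 - j).toNat, ?_⟩
      have h2 : (((-1 - j).toNat : ℕ) : ℤ) = -1 - j := Int.toNat_of_nonneg (by omega)
      simp only [h2]
      congr 2
      omega
  have mp : ∀ {f : ℤ → ℝ}, IsLabeling L f → StrictMono (fun k : ℕ => f k) :=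
    fun hf i j hij => hf.strictMono (by exact_mod_cast hij)
  have mq : ∀ {f : ℤ → ℝ}, IsLabeling L f → StrictMono (fun k : ℕ => -f (-1 - k)) :=
    fun hf i j hij => neg_lt_neg (hf.strictMono (by omega))
  have e1 := (StrictMono.range_inj (mp h) (mp h')).1 ((hp h).trans (hp h').symm)
  have e2 := (StrictMono.range_inj (mq h) (mq h')).1 ((hq h).trans (hq h').symm)
  funext j
  rcases le_or_gt 0 j with hj | hj
  · have := congrFun e1 j.toNat
    simpa [hj] using this
  · have := congrFun e2 (-1 - j).toNat
    have h2 : (((-1 - j).toNat : ℕ) : ℤ) = -1 - j := Int.toNat_of_nonneg (by omega)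
    simpa [h2] using this

/-- The unique increasing labeling `(λ_j)` of `L` with `λ_{-1} < 0 ≤ λ_0`. -/
def PointSet.label (L : PointSet) : ℤ → ℝ := (exists_isLabeling L).choose

theorem PointSet.isLabeling_label (L : PointSet) : IsLabeling L.carrier L.label :=
  (exists_isLabeling L).choose_spec

/-- The truncated Stieltjes transform `∑_{λ ∈ L ∩ [-c, c]} γ_λ / (λ - z)` of
`Λ = ∑_j γ_j δ_{λ_j}`; the sum is finite. -/
def truncatedStieltjes (L : PointSet) (γ : ℤ → ℝ) (c : ℝ) (z : ℂ) : ℂ :=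
  ∑ᶠ (j : ℤ) (_ : L.label j ∈ Icc (-c) c), (γ j : ℂ) / ((L.label j : ℂ) - z)

/-- `S_Λ(z) = w`, for `z` outside the support `L` of `Λ = ∑_j γ_j δ_{λ_j}`: the truncated transforms
converge to `w` as `c → ∞`. -/
def IsStieltjesValue (L : PointSet) (γ : ℤ → ℝ) (z w : ℂ) : Prop :=
  (∀ x ∈ L.carrier, z ≠ (x : ℂ)) ∧
    Tendsto (fun c : ℝ => truncatedStieltjes L γ c z) atTop (𝓝 w)

/-- The level set `S_Λ⁻¹(h)` as a set of reals (for real `h` it has no non-real element, as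
`Im S_Λ(z)` has the sign of `Im z`). -/
def levelSet (L : PointSet) (γ : ℤ → ℝ) (h : ℝ) : Set ℝ :=
  {x : ℝ | IsStieltjesValue L γ (x : ℂ) (h : ℂ)}

open Classical in
/-- The transition map `𝒟 : 𝓛 × (Γ × ℝ) → 𝓛`, `(L, (γ, h)) ↦ S_Λ⁻¹(h)`. The second branch is a
placeholder needed for totality; `IsInvariantLaw` requires that it is not used. -/
def transition (p : PointSet × (Weights × ℝ)) : PointSet :=
  if H : IsPointSet (levelSet p.1 p.2.1.1 p.2.2) then ⟨_, H⟩ else p.1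

/-- `ℚ` is an invariant law of the Markov chain `X_{k+1} = 𝒟(X_k, G_k)`, with `G_k` a fresh sample
of `Π`: if `(L, G)` has law `ℚ ⊗ Π`, then almost surely the level set belongs to `𝓛`, and `𝒟(L, G)`
is a random element of `𝓛` with law `ℚ`. -/
def IsInvariantLaw (P : Measure (Weights × ℝ)) (Q : Measure PointSet) : Prop :=
  (∀ᵐ p ∂(Q.prod P), IsPointSet (levelSet p.1 p.2.1.1 p.2.2)) ∧
    HasLaw transition Q (Q.prod P)

instance : MeasurableSpace Circle := borel Circle

instance : BorelSpace Circle := ⟨rfl⟩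

/-- `Φ` is a monic polynomial of degree `k` orthogonal to `1, z, …, z^{k-1}` in `L²(μ)`. -/
def IsMonicOrthogonal (μ : Measure Circle) (k : ℕ) (Φ : Polynomial ℂ) : Prop :=
  Φ.Monic ∧ Φ.natDegree = k ∧
    ∀ j < k, ∫ z : Circle, conj ((z : ℂ) ^ j) * Φ.eval (z : ℂ) ∂μ = 0

open Classical in
/-- The Verblunsky coefficient `α_k = - conj (Φ_{k+1}(0))`, where `Φ_{k+1}` is the monic orthogonal
polynomial of degree `k + 1` for `μ`. If the support of `μ` has `n` points then `Φ_1, …, Φ_n` are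
unique, so that `α_0, …, α_{n-1}` are well defined (and `|α_{n-1}| = 1`). -/
def verblunsky (μ : Measure Circle) (k : ℕ) : ℂ :=
  if H : ∃ Φ, IsMonicOrthogonal μ (k + 1) Φ then - conj (H.choose.eval 0) else 0

/-- `L` is `2πn`-periodic with exactly `n` points in `[0, 2πn)`. -/
def PointSet.IsPeriodic (n : ℕ) (L : PointSet) : Prop :=
  (∀ x : ℝ, x + 2 * Real.pi * n ∈ L.carrier ↔ x ∈ L.carrier) ∧
    (L.carrier ∩ Ico 0 (2 * Real.pi * n)).ncard = n

/-- The points `u_{i+1} = exp(i λ_i / n)` on the unit circle, `0 ≤ i < n`; for periodic `L` these are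
the `n` points of which `L` is the lift, listed by increasing argument in `[0, 2π)`. -/
def circlePoint (n : ℕ) (L : PointSet) (i : Fin n) : Circle :=
  Circle.exp (L.label (i : ℤ) / n)

/-- `σ = (1 / 2n) ∑_{j=1}^n γ_j δ_{u_j}`, with `j = i + 1`. -/
def circleMeasure (n : ℕ) (L : PointSet) (γ : ℤ → ℝ) : Measure Circle :=
  ∑ i : Fin n, ENNReal.ofReal (γ ((i : ℤ) + 1) / (2 * n)) • Measure.dirac (circlePoint n L i)

end StieltjesChain

end

/-! Put w = e^{ix/n}, s_i = γ_i/(2n), and let F(w) = ∑ s_i (u_i + w)/(u_i - w) be the Carathéodory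
function of the measure ∑ s_i δ_{u_i}. Grouping the Stieltjes series by residues of the label mod n
and using the cotangent expansion gives S_Λ(x) = i F(w) (`tendsto_truncatedStieltjes`). So S_Λ(x) =
h reads F - 1 = conj η (F + 1), where η = (ih - 1)/(ih + 1) is a point of the unit circle other than
1 (`eq_level_iff`).

Let α be the Verblunsky coefficients of ∑ s_i δ_{u_i}. The Szegő recursion with coefficients α,
started from (1, 1), produces the orthogonal polynomials and their reverses; at degree n the
polynomial is ∏ (w - u_i), whose zeros lift to L. Started from (F + 1, F - 1), its first component
vanishes at step n, because it is a transform of Φ_n(u_i) = 0. Started from (1, conj η), its first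
component is the polynomial with coefficients αη. Writing (1, conj η) in terms of the two previous
initial values shows that the zeros for αη are exactly the solutions of F - 1 = conj η (F + 1)
(`szego_rotate_eq_zero_iff`, `mem_levelSet_iff`).

Thus L and its image under the chain arise from α and from αη by one and the same measurable map
(`zeroPointSet`). Since η depends only on h, it is independent of α, and a rotation-invariant law of
α is unchanged by the factor η (`map_mul_rotation`). The measure σ carries γ_{i+1} where the
Stieltjes transform carries γ_i; exchangeability and periodicity absorb this cyclic shift
(`map_shift_eq`). -/

namespace StieltjesChain

/-! ### The Szegő recursion at a point and as a recursion of polynomials -/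

/-- One step of the Szegő recursion at the point `w` with coefficient `α`. -/
def szegoStep (w α : ℂ) (v : ℂ × ℂ) : ℂ × ℂ :=
  (w * v.1 - conj α * v.2, v.2 - α * w * v.1)

/-- The Szegő recursion at the point `w` with coefficients `α`, started from `v`. -/
def szego (α : ℕ → ℂ) (w : ℂ) (v : ℂ × ℂ) : ℕ → ℂ × ℂ
  | 0 => v
  | k + 1 => szegoStep w (α k) (szego α w v k)

theorem szego_succ_fst (α : ℕ → ℂ) (w : ℂ) (v : ℂ × ℂ) (k : ℕ) :
    (szego α w v (k + 1)).1 = w * (szego α w v k).1 - conj (α k) * (szego α w v k).2 := rfl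

theorem szego_succ_snd (α : ℕ → ℂ) (w : ℂ) (v : ℂ × ℂ) (k : ℕ) :
    (szego α w v (k + 1)).2 = (szego α w v k).2 - α k * w * (szego α w v k).1 := rfl

theorem szego_congr {α β : ℕ → ℂ} {n : ℕ} (h : ∀ k < n, α k = β k) (w : ℂ) (v : ℂ × ℂ) :
    szego α w v n = szego β w v n := by
  induction n with
  | zero => rfl
  | succ n ih =>
    simp only [szego, h n (Nat.lt_succ_self n), ih fun k hk => h k (hk.trans (Nat.lt_succ_self n))]

theorem szego_linear (α : ℕ → ℂ) (w c d : ℂ) (v v' : ℂ × ℂ) (k : ℕ) :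
    szego α w (c • v + d • v') k = c • szego α w v k + d • szego α w v' k := by
  induction k with
  | zero => rfl
  | succ k ih =>
    ext
    · simp only [szego_succ_fst, ih, Prod.fst_add, Prod.snd_add, Prod.smul_fst, Prod.smul_snd,
        smul_eq_mul]
      ring
    · simp only [szego_succ_snd, ih, Prod.fst_add, Prod.snd_add, Prod.smul_fst, Prod.smul_snd,
        smul_eq_mul]
      ring

/-- Rotating the coefficients amounts to changing the initial value of the second component. -/
theorem szego_rotate (α : ℕ → ℂ) (w η : ℂ) (hη : conj η * η = 1) (k : ℕ) :
    szego α w (1, conj η) k =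
      ((szego (fun k => α k * η) w (1, 1) k).1,
        conj η * (szego (fun k => α k * η) w (1, 1) k).2) := by
  induction k with
  | zero => simp [szego]
  | succ k ih =>
    ext
    · simp only [szego_succ_fst, ih, map_mul]
      ring
    · simp only [szego_succ_snd, ih]
      linear_combination (-α k * w * (szego (fun k => α k * η) w (1, 1) k).1) * (-hη)

/-- On the unit circle the recursion commutes with the reversal (a, b) ↦ (w^k conj b, w^k conj a),
which fixes the initial value (1, 1). So the second component is the reversed polynomial. -/
theorem szego_snd_eq (α : ℕ → ℂ) (w : ℂ) (hw : conj w * w = 1) (k : ℕ) :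
    (szego α w (1, 1) k).2 = w ^ k * conj (szego α w (1, 1) k).1 := by
  induction k with
  | zero => simp [szego]
  | succ k ih =>
    have hk : conj w ^ k * w ^ k = 1 := by rw [← mul_pow, hw, one_pow]
    have ih' : conj (szego α w (1, 1) k).2 = conj w ^ k * (szego α w (1, 1) k).1 := by
      rw [ih]; simp
    simp only [szego_succ_fst, szego_succ_snd, map_sub, map_mul, Complex.conj_conj]
    rw [ih', ih]
    set a := (szego α w (1, 1) k).1
    linear_combination (-(w ^ k * conj a)) * hw + (α k * w * a) * hk

/-- One step is linear in the pair, with determinant w (1 - |α_k|²); two independent solutions stay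
independent as long as w ≠ 0 and |α_k| ≠ 1. -/
theorem szego_wronskian (α : ℕ → ℂ) (w : ℂ) (v v' : ℂ × ℂ) (k : ℕ) :
    (szego α w v (k + 1)).1 * (szego α w v' (k + 1)).2
        - (szego α w v' (k + 1)).1 * (szego α w v (k + 1)).2 =
      w * (1 - α k * conj (α k)) *
        ((szego α w v k).1 * (szego α w v' k).2 - (szego α w v' k).1 * (szego α w v k).2) := by
  simp only [szego_succ_fst, szego_succ_snd]
  ring

/-- The polynomials produced by the Szegő recursion from the initial value `(1, 1)`. -/
noncomputable def szegoPoly (α : ℕ → ℂ) : ℕ → Polynomial ℂ × Polynomial ℂ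
  | 0 => (1, 1)
  | k + 1 => (Polynomial.X * (szegoPoly α k).1 - Polynomial.C (conj (α k)) * (szegoPoly α k).2,
      (szegoPoly α k).2 - Polynomial.C (α k) * Polynomial.X * (szegoPoly α k).1)

theorem eval_szegoPoly (α : ℕ → ℂ) (w : ℂ) (k : ℕ) :
    (szegoPoly α k).1.eval w = (szego α w (1, 1) k).1 ∧
      (szegoPoly α k).2.eval w = (szego α w (1, 1) k).2 := by
  induction k with
  | zero => simp [szegoPoly, szego]
  | succ k ih => simp [szegoPoly, szego, szegoStep, ih.1, ih.2]

theorem szegoPoly_monic (α : ℕ → ℂ) (k : ℕ) :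
    (szegoPoly α k).1.Monic ∧ (szegoPoly α k).1.natDegree = k ∧
      (szegoPoly α k).2.natDegree ≤ k := by
  induction k with
  | zero => simp [szegoPoly]
  | succ k ih =>
    obtain ⟨hm, hd, hd'⟩ := ih
    have hX : (Polynomial.X * (szegoPoly α k).1).natDegree = k + 1 := by
      rw [Polynomial.natDegree_X_mul hm.ne_zero, hd]
    have hC : ∀ c : ℂ, (Polynomial.C c * (szegoPoly α k).2).natDegree ≤ k := fun c =>
      (Polynomial.natDegree_C_mul_le _ _).trans hd'
    have hXm : (Polynomial.X * (szegoPoly α k).1).Monic := Polynomial.monic_X.mul hm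
    have hlt : (Polynomial.C (conj (α k)) * (szegoPoly α k).2).natDegree
        < (Polynomial.X * (szegoPoly α k).1).natDegree := by
      rw [hX]; exact Nat.lt_succ_of_le (hC _)
    refine ⟨?_, ?_, ?_⟩
    · refine hXm.sub_of_left ?_
      exact Polynomial.degree_lt_degree hlt
    · show (Polynomial.X * (szegoPoly α k).1 - _).natDegree = k + 1
      rw [Polynomial.natDegree_sub_eq_left_of_natDegree_lt hlt, hX]
    · refine (Polynomial.natDegree_sub_le _ _).trans (max_le (hd'.trans (Nat.le_succ k)) ?_)
      rw [mul_assoc]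
      exact (Polynomial.natDegree_C_mul_le _ _).trans hX.le

/-- Makes the first component at w = 0 equal to -conj α_k after step k, so that the recursion
coefficient can be matched with the definition of `verblunsky`. -/
theorem szego_zero_snd (α : ℕ → ℂ) (k : ℕ) : (szego α 0 (1, 1) k).2 = 1 := by
  induction k with
  | zero => rfl
  | succ k ih => simp [szego_succ_snd, ih]

/-! ### Orthogonal polynomials of a finite sum of atoms -/

section Atoms

variable {ι : Type*} [Fintype ι]

/-- The Verblunsky coefficient read off from the values `v` of the orthogonal polynomial and of its
reverse at the atoms `u`, for the weights `s`. -/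
noncomputable def atomCoeff (u : ι → ℂ) (s : ι → ℝ) (v : ι → ℂ × ℂ) : ℂ :=
  conj ((∑ i, s i * (u i * (v i).1)) / ∑ i, s i * (v i).2)

/-- The values at the atoms `u` of the orthogonal polynomials of `∑ s_i δ_{u_i}` and of their
reverses, computed recursively. -/
noncomputable def atomValues (u : ι → ℂ) (s : ι → ℝ) : ℕ → ι → ℂ × ℂ
  | 0 => fun _ => (1, 1)
  | k + 1 => fun i => szegoStep (u i) (atomCoeff u s (atomValues u s k)) (atomValues u s k i)

/-- The Verblunsky coefficients of `∑ s_i δ_{u_i}`, computed recursively. -/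
noncomputable def atomVerblunsky (u : ι → ℂ) (s : ι → ℝ) (k : ℕ) : ℂ :=
  atomCoeff u s (atomValues u s k)

theorem atomValues_eq (u : ι → ℂ) (s : ι → ℝ) (k : ℕ) (i : ι) :
    atomValues u s k i = szego (atomVerblunsky u s) (u i) (1, 1) k := by
  induction k generalizing i with
  | zero => rfl
  | succ k ih =>
    show szegoStep _ _ _ = szegoStep _ _ _
    rw [ih, atomVerblunsky]

theorem conj_coe_mul_coe (z : Circle) : conj (z : ℂ) * (z : ℂ) = 1 := by
  rw [← Complex.normSq_eq_conj_mul_self]; simp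

theorem conj_atomVerblunsky (u : ι → ℂ) (s : ι → ℝ) (k : ℕ) :
    conj (atomVerblunsky u s k) = (∑ i, s i * (u i * (szego (atomVerblunsky u s) (u i) (1, 1) k).1))
      / ∑ i, s i * (szego (atomVerblunsky u s) (u i) (1, 1) k).2 := by
  conv_lhs => rw [atomVerblunsky, atomCoeff, Complex.conj_conj]
  simp only [atomValues_eq]

variable {u : ι → Circle} {s : ι → ℝ}

/-- Expanding D in monomials, D is orthogonal to itself, so it vanishes at every atom; its degree is
below the number of atoms. All uniqueness statements for orthogonal polynomials rest on this. -/
theorem eq_zero_of_orthogonal (hu : Function.Injective u) (hs : ∀ i, 0 < s i)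
    {D : Polynomial ℂ} {m : ℕ} (hm : m ≤ Fintype.card ι) (hD : D.degree < m)
    (h : ∀ j < m, ∑ i, s i * (conj ((u i : ℂ) ^ j) * D.eval (u i : ℂ)) = 0) : D = 0 := by
  rcases eq_or_ne D 0 with h0 | h0
  · exact h0
  have key : ∑ i, s i * (conj (D.eval (u i : ℂ)) * D.eval (u i : ℂ)) = 0 := by
    have : ∀ i, conj (D.eval (u i : ℂ)) =
        ∑ j ∈ Finset.range m, conj (D.coeff j) * conj ((u i : ℂ) ^ j) := by
      intro i
      rw [Polynomial.eval_eq_sum_range' ((Polynomial.natDegree_lt_iff_degree_lt h0).2 hD), map_sum]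
      simp only [map_mul]
    simp only [this, Finset.sum_mul, Finset.mul_sum]
    rw [Finset.sum_comm]
    refine Finset.sum_eq_zero fun j hj => ?_
    have := h j (Finset.mem_range.1 hj)
    calc _ = conj (D.coeff j) * ∑ i, s i * (conj ((u i : ℂ) ^ j) * D.eval (u i : ℂ)) := by
          rw [Finset.mul_sum]
          exact Finset.sum_congr rfl fun i _ => by ring
      _ = 0 := by rw [this, mul_zero]
  have key' : ∑ i, s i * Complex.normSq (D.eval (u i : ℂ)) = 0 := by
    simp only [← Complex.normSq_eq_conj_mul_self] at key
    exact_mod_cast key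
  rw [Finset.sum_eq_zero_iff_of_nonneg
    fun i _ => mul_nonneg (hs i).le (Complex.normSq_nonneg _)] at key'
  refine Polynomial.eq_zero_of_degree_lt_of_eval_finset_eq_zero
    (Finset.univ.map ⟨fun i => (u i : ℂ), fun i j hij => hu (Circle.ext hij)⟩) ?_ ?_
  · rw [Finset.card_map, Finset.card_univ]
    exact hD.trans_le (by exact_mod_cast hm)
  · intro x hx
    simp only [Finset.mem_map, Finset.mem_univ, true_and] at hx
    obtain ⟨i, rfl⟩ := hx
    have := key' i (Finset.mem_univ i)
    rcases mul_eq_zero.1 this with h1 | h1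
    · exact absurd h1 (hs i).ne'
    · exact Complex.normSq_eq_zero.1 h1

theorem _root_.Polynomial.Monic.degree_sub_lt {p q : Polynomial ℂ} (hp : p.Monic) (hq : q.Monic)
    {m : ℕ} (hpm : p.natDegree = m) (hqm : q.natDegree = m) : (p - q).degree < m := by
  have h := Polynomial.degree_sub_lt_left (p := p) (q := q) ?_ hp.ne_zero ?_
  · rwa [Polynomial.degree_eq_natDegree hp.ne_zero, hpm] at h
  · rw [Polynomial.degree_eq_natDegree hp.ne_zero, Polynomial.degree_eq_natDegree hq.ne_zero,
      hpm, hqm]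
  · rw [hp.leadingCoeff, hq.leadingCoeff]

/-- The squared norm of the monic orthogonal polynomial does not vanish. -/
theorem sum_szego_snd_ne_zero (hu : Function.Injective u) (hs : ∀ i, 0 < s i) (α : ℕ → ℂ)
    {k : ℕ} (hk : k < Fintype.card ι)
    (h : ∀ j < k, ∑ i, s i * (conj ((u i : ℂ) ^ j) * (szego α (u i) (1, 1) k).1) = 0) :
    ∑ i, s i * (szego α (u i) (1, 1) k).2 ≠ 0 := by
  intro h0
  have hA := szegoPoly_monic α k
  -- By reversal, the sum is the conjugate of the pairing of Φ_k with z^k. If it vanished, Φ_k would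
  -- be orthogonal to 1, …, z^k, hence zero, although it is monic.
  have : (szegoPoly α k).1 = 0 := by
    refine eq_zero_of_orthogonal hu hs (m := k + 1) hk ?_ ?_
    · rw [Polynomial.degree_eq_natDegree hA.1.ne_zero, hA.2.1]
      exact_mod_cast Nat.lt_succ_self k
    · intro j hj
      simp only [(eval_szegoPoly α _ k).1]
      rcases Nat.lt_succ_iff_lt_or_eq.1 hj with hj | rfl
      · exact h j hj
      · have : conj (∑ i, s i * (szego α (u i) (1, 1) j).2) = 0 := by rw [h0, map_zero]
        rw [map_sum] at this
        rw [← this]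
        refine Finset.sum_congr rfl fun i _ => ?_
        rw [szego_snd_eq α _ (conj_coe_mul_coe _)]
        simp
  exact hA.1.ne_zero this

/-- Induction on the degree. Orthogonality of Φ_{k+1} to 1 is what the choice of α_k achieves. For
z^{j+1}, the term zΦ_k reduces to the pairing of Φ_k with z^j, and the reversed polynomial to the
conjugate of its pairing with z^{k-j-1}; both vanish. -/
theorem szego_orthogonal (hu : Function.Injective u) (hs : ∀ i, 0 < s i)
    {k : ℕ} (hk : k ≤ Fintype.card ι) : ∀ j < k, ∑ i, s i * (conj ((u i : ℂ) ^ j) *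
      (szego (atomVerblunsky (fun i => (u i : ℂ)) s) (u i) (1, 1) k).1) = 0 := by
  induction k with
  | zero => intro j hj; omega
  | succ k ih =>
    have ih := ih (Nat.le_of_succ_le hk)
    have hne := sum_szego_snd_ne_zero hu hs _ hk ih
    have hα := conj_atomVerblunsky (fun i => (u i : ℂ)) s k
    rw [eq_div_iff hne] at hα
    intro j hj
    simp only [szego_succ_fst]
    set α := atomVerblunsky (fun i => (u i : ℂ)) s
    have split : ∑ i, s i * (conj ((u i : ℂ) ^ j) * ((u i : ℂ) * (szego α (u i) (1, 1) k).1
          - conj (α k) * (szego α (u i) (1, 1) k).2)) =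
        ∑ i, s i * (conj ((u i : ℂ) ^ j) * ((u i : ℂ) * (szego α (u i) (1, 1) k).1))
          - conj (α k) * ∑ i, s i * (conj ((u i : ℂ) ^ j) * (szego α (u i) (1, 1) k).2) := by
      rw [Finset.mul_sum, ← Finset.sum_sub_distrib]
      exact Finset.sum_congr rfl fun i _ => by ring
    rw [split]
    rcases j with _ | j
    · simp only [pow_zero, map_one, one_mul]
      rw [hα, sub_self]
    · have h1 : ∑ i, s i * (conj ((u i : ℂ) ^ (j + 1)) *
          ((u i : ℂ) * (szego α (u i) (1, 1) k).1)) = 0 := by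
        rw [← ih j (by omega)]
        refine Finset.sum_congr rfl fun i _ => ?_
        rw [pow_succ, map_mul]
        linear_combination (s i * conj ((u i : ℂ) ^ j) * (szego α (u i) (1, 1) k).1) *
          conj_coe_mul_coe (u i)
      have h2 : ∑ i, s i * (conj ((u i : ℂ) ^ (j + 1)) * (szego α (u i) (1, 1) k).2) = 0 := by
        have := congrArg conj (ih (k - (j + 1)) (by omega))
        rw [map_zero, map_sum] at this
        rw [← this]
        refine Finset.sum_congr rfl fun i _ => ?_
        rw [szego_snd_eq α _ (conj_coe_mul_coe _)]
        have hp : (u i : ℂ) ^ k = (u i : ℂ) ^ (k - (j + 1)) * (u i : ℂ) ^ (j + 1) := by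
          rw [← pow_add]; congr 1; omega
        have h1 : conj ((u i : ℂ) ^ (j + 1)) * (u i : ℂ) ^ (j + 1) = 1 := by
          rw [map_pow, ← mul_pow, conj_coe_mul_coe, one_pow]
        rw [hp]
        simp only [map_mul, Complex.conj_conj, Complex.conj_ofReal]
        linear_combination (s i * (u i : ℂ) ^ (k - (j + 1)) *
          conj (szego α (u i) (1, 1) k).1) * h1
      rw [h1, h2, mul_zero, sub_zero]

/-- Both polynomials are monic of degree n, and the product vanishes at all atoms, so the difference
has lower degree and is orthogonal to 1, …, z^{n-1}. -/
theorem szegoPoly_card (hu : Function.Injective u) (hs : ∀ i, 0 < s i) :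
    (szegoPoly (atomVerblunsky (fun i => (u i : ℂ)) s) (Fintype.card ι)).1 =
      ∏ i, (Polynomial.X - Polynomial.C (u i : ℂ)) := by
  set α := atomVerblunsky (fun i => (u i : ℂ)) s
  obtain ⟨hm, hd, -⟩ := szegoPoly_monic α (Fintype.card ι)
  have hm' : (∏ i, (Polynomial.X - Polynomial.C (u i : ℂ))).Monic :=
    Polynomial.monic_prod_of_monic _ _ fun i _ => Polynomial.monic_X_sub_C _
  have hd' : (∏ i, (Polynomial.X - Polynomial.C (u i : ℂ))).natDegree = Fintype.card ι := by
    rw [Polynomial.natDegree_finsetProd_X_sub_C_eq_card]; simp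
  rw [← sub_eq_zero]
  refine eq_zero_of_orthogonal hu hs le_rfl (hm.degree_sub_lt hm' hd hd') ?_
  · intro j hj
    rw [← szego_orthogonal hu hs le_rfl j hj]
    refine Finset.sum_congr rfl fun i _ => ?_
    rw [Polynomial.eval_sub, (eval_szegoPoly α _ _).1, Polynomial.eval_prod,
      Finset.prod_eq_zero (Finset.mem_univ i) (by simp), sub_zero]

theorem szego_card (hu : Function.Injective u) (hs : ∀ i, 0 < s i) (w : ℂ) :
    (szego (atomVerblunsky (fun i => (u i : ℂ)) s) w (1, 1) (Fintype.card ι)).1 =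
      ∏ i, (w - u i) := by
  rw [← (eval_szegoPoly _ _ _).1, szegoPoly_card hu hs, Polynomial.eval_prod]
  simp

/-- The recursion ‖Φ_{k+1}‖² = (1 - |α_k|²) ‖Φ_k‖² for squared norms, each written as the integral
of the reversed polynomial. -/
theorem sum_szego_snd_succ (hu : Function.Injective u) (hs : ∀ i, 0 < s i)
    {k : ℕ} (hk : k < Fintype.card ι) :
    let α := atomVerblunsky (fun i => (u i : ℂ)) s
    ∑ i, s i * (szego α (u i) (1, 1) (k + 1)).2 =
      (1 - α k * conj (α k)) * ∑ i, s i * (szego α (u i) (1, 1) k).2 := by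
  intro α
  have hne := sum_szego_snd_ne_zero hu hs _ hk (szego_orthogonal hu hs hk.le)
  have hα := conj_atomVerblunsky (fun i => (u i : ℂ)) s k
  rw [eq_div_iff hne] at hα
  simp only [szego_succ_snd]
  rw [sub_mul, one_mul, mul_assoc, hα, Finset.mul_sum, ← Finset.sum_sub_distrib]
  exact Finset.sum_congr rfl fun i _ => by ring

/-- The squared norms of Φ_k and Φ_{k+1} are both nonzero. The last index is excluded because Φ_n
vanishes at all atoms. -/
theorem one_sub_atomVerblunsky_ne_zero (hu : Function.Injective u) (hs : ∀ i, 0 < s i)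
    {k : ℕ} (hk : k + 1 < Fintype.card ι) :
    1 - atomVerblunsky (fun i => (u i : ℂ)) s k * conj (atomVerblunsky (fun i => (u i : ℂ)) s k)
      ≠ 0 := by
  intro h
  have h1 := sum_szego_snd_succ hu hs (Nat.lt_of_succ_lt hk)
  have h2 := sum_szego_snd_ne_zero hu hs _ hk (szego_orthogonal hu hs hk.le)
  simp only [h, zero_mul] at h1
  exact h2 h1

/-- The Carathéodory function `∑ s_i (u_i + w) / (u_i - w)` of `∑ s_i δ_{u_i}`. -/
noncomputable def caratheodory (u : ι → Circle) (s : ι → ℝ) (w : ℂ) : ℂ :=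
  ∑ i, s i * (((u i : ℂ) + w) / (u i - w))

/-- The solution of the Szegő recursion started from `(F + 1, F - 1)`, with `F` the Carathéodory
function, in terms of the Cauchy-type transforms of the orthogonal polynomials. -/
theorem szego_caratheodory (hu : Function.Injective u) (hs : ∀ i, 0 < s i) (hs1 : ∑ i, s i = 1)
    {w : ℂ} (hw : ∀ i, (u i : ℂ) ≠ w) {k : ℕ} (hk : k < Fintype.card ι) :
    let α := atomVerblunsky (fun i => (u i : ℂ)) s
    let F := caratheodory u s w
    szego α w (F + 1, F - 1) (k + 1) =
      (∑ i, s i * (((u i : ℂ) + w) / (u i - w) * (szego α (u i) (1, 1) (k + 1)).1),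
        ∑ i, s i * (((u i : ℂ) + w) / (u i - w) * (szego α (u i) (1, 1) (k + 1)).2)
          - ∑ i, s i * (szego α (u i) (1, 1) (k + 1)).2) := by
  intro α F
  have hα : ∀ {k : ℕ}, k < Fintype.card ι →
      conj (α k) * ∑ i, s i * (szego α (u i) (1, 1) k).2 =
        ∑ i, s i * ((u i : ℂ) * (szego α (u i) (1, 1) k).1) := fun {k} hk => by
    have hne := sum_szego_snd_ne_zero hu hs _ hk (szego_orthogonal hu hs hk.le)
    have hα := conj_atomVerblunsky (fun i => (u i : ℂ)) s k
    rwa [eq_div_iff hne] at hα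
  -- Inside the integral the recursion runs at u_i instead of w. Since u_i - w cancels the kernel's
  -- denominator, replacing u_i by w costs only the integral of (u_i + w)Φ_k: its u_i-part is given
  -- by α_k and its w-part vanishes by orthogonality once k ≥ 1.
  have hA : ∀ k, ∑ i, s i * (((u i : ℂ) + w) / (u i - w) * (szego α (u i) (1, 1) (k + 1)).1) =
      w * ∑ i, s i * (((u i : ℂ) + w) / (u i - w) * (szego α (u i) (1, 1) k).1)
      - conj (α k) * ∑ i, s i * (((u i : ℂ) + w) / (u i - w) * (szego α (u i) (1, 1) k).2)
      + ∑ i, s i * ((u i : ℂ) * (szego α (u i) (1, 1) k).1)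
      + w * ∑ i, s i * (szego α (u i) (1, 1) k).1 := by
    intro k
    simp only [szego_succ_fst, Finset.mul_sum, ← Finset.sum_sub_distrib, ← Finset.sum_add_distrib]
    refine Finset.sum_congr rfl fun i _ => ?_
    have := sub_ne_zero.2 (hw i)
    field_simp
    ring
  have hB : ∀ k, ∑ i, s i * (((u i : ℂ) + w) / (u i - w) * (szego α (u i) (1, 1) (k + 1)).2) =
      ∑ i, s i * (((u i : ℂ) + w) / (u i - w) * (szego α (u i) (1, 1) k).2)
      - α k * w * ∑ i, s i * (((u i : ℂ) + w) / (u i - w) * (szego α (u i) (1, 1) k).1)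
      - α k * ∑ i, s i * ((u i : ℂ) * (szego α (u i) (1, 1) k).1)
      - α k * w * ∑ i, s i * (szego α (u i) (1, 1) k).1 := by
    intro k
    simp only [szego_succ_snd, Finset.mul_sum, ← Finset.sum_sub_distrib]
    refine Finset.sum_congr rfl fun i _ => ?_
    have := sub_ne_zero.2 (hw i)
    field_simp
    ring
  -- At index 0 the right side would be (F, F - 1), not the initial value, so the induction starts
  -- after one step. There the integral of Φ_0 is 1 instead of 0, which accounts for F + 1.
  induction k with
  | zero =>
    have hs1' : ∑ i, (s i : ℂ) = 1 := by exact_mod_cast hs1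
    have e := sum_szego_snd_succ hu hs hk
    have h0 := hα hk
    have a := hA 0
    have b := hB 0
    simp only [szego, mul_one, hs1'] at e h0 a b
    have hF : ∑ i, (s i : ℂ) * (((u i : ℂ) + w) / (u i - w)) = F := rfl
    rw [hF] at a b
    ext
    · show w * (F + 1) - conj (α 0) * (F - 1) = _
      simp only [szego]
      rw [a, ← h0]; ring
    · show F - 1 - α 0 * w * (F + 1) = _
      simp only [szego]
      rw [b, e, ← h0]; ring
  | succ k ih =>
    have ih := ih (Nat.lt_of_succ_lt hk)
    have e := sum_szego_snd_succ hu hs hk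
    have h0 := hα hk
    have h1 : ∑ i, s i * (szego α (u i) (1, 1) (k + 1)).1 = 0 := by
      simpa using szego_orthogonal hu hs hk.le 0 (Nat.succ_pos k)
    ext
    · rw [szego_succ_fst, ih, hA (k + 1), ← h0, h1]; ring
    · rw [szego_succ_snd, ih, hB (k + 1), ← h0, h1]
      simp only
      rw [e]; ring

/-- The zeros of the orthogonal polynomial of full degree for the rotated Verblunsky coefficients,
as a level set of the Carathéodory function. -/
theorem szego_rotate_eq_zero_iff [Nonempty ι] (hu : Function.Injective u) (hs : ∀ i, 0 < s i)
    (hs1 : ∑ i, s i = 1) {η : ℂ} (hη : conj η * η = 1) (hη1 : η ≠ 1) {w : ℂ} (hw0 : w ≠ 0) :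
    (szego (fun k => atomVerblunsky (fun i => (u i : ℂ)) s k * η) w (1, 1) (Fintype.card ι)).1 = 0
      ↔ (∀ i, (u i : ℂ) ≠ w) ∧
        caratheodory u s w - 1 = conj η * (caratheodory u s w + 1) := by
  have hrot := szego_rotate (atomVerblunsky (fun i => (u i : ℂ)) s) w η hη (Fintype.card ι)
  rw [show (szego (fun k => atomVerblunsky (fun i => (u i : ℂ)) s k * η) w (1, 1)
    (Fintype.card ι)).1 = (szego (atomVerblunsky (fun i => (u i : ℂ)) s) w (1, conj η)
    (Fintype.card ι)).1 by rw [hrot]]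
  have hcard := szego_card hu hs w
  have hn : 0 < Fintype.card ι := Fintype.card_pos
  set α := atomVerblunsky (fun i => (u i : ℂ)) s
  obtain ⟨m, hm⟩ := Nat.exists_eq_succ_of_ne_zero hn.ne'
  have hη2 : conj η ≠ 1 := fun h => hη1 (by rw [← Complex.conj_conj η, h, map_one])
  by_cases hw : ∀ i, (u i : ℂ) ≠ w
  · simp only [hw, not_false_eq_true, implies_true, ne_eq, true_and]
    set F := caratheodory u s w
    have h0 : (szego α w (F + 1, F - 1) (Fintype.card ι)).1 = 0 := by
      have := szego_caratheodory hu hs hs1 hw (k := m) (by omega)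
      simp only at this
      rw [hm, this]
      simp only
      refine Finset.sum_eq_zero fun i _ => ?_
      have h2 := szego_card hu hs (u i)
      rw [Finset.prod_eq_zero (Finset.mem_univ i) (sub_self _), hm] at h2
      rw [h2, mul_zero, mul_zero]
    have h1 : (szego α w (1, 1) (Fintype.card ι)).1 ≠ 0 := by
      rw [hcard]
      exact Finset.prod_ne_zero_iff.2 fun i _ => sub_ne_zero.2 (hw i).symm
    have lin4 := szego_linear α w (1 - conj η) ((F + 1) * conj η - (F - 1)) (F + 1, F - 1) (1, 1)
      (Fintype.card ι)
    have lin6 := szego_linear α w 2 0 (1, conj η) (1, 1) (Fintype.card ι)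
    -- Away from the atoms the first component of the (1, 1) solution is nonzero at step n and that
    -- of (F + 1, F - 1) is zero. Hence the (1, conj η) solution vanishes exactly when its
    -- coefficient on (1, 1) does.
    rw [show (2 : ℂ) • ((1 : ℂ), conj η) + (0 : ℂ) • ((1 : ℂ), (1 : ℂ)) =
      (1 - conj η) • (F + 1, F - 1) + ((F + 1) * conj η - (F - 1)) • ((1 : ℂ), (1 : ℂ)) by
        ext <;> simp <;> ring, lin4] at lin6
    have lin7 := congrArg Prod.fst lin6
    simp only [Prod.fst_add, Prod.smul_fst, h0, smul_eq_mul, mul_zero, zero_mul, zero_add,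
      add_zero] at lin7
    constructor
    · intro h
      rw [h, mul_zero] at lin7
      rcases mul_eq_zero.1 lin7 with h2 | h2
      · linear_combination -h2
      · exact absurd h2 h1
    · intro h
      have : (F + 1) * conj η - (F - 1) = 0 := by linear_combination -h
      rw [this, zero_mul] at lin7
      exact (mul_eq_zero.1 lin7.symm).resolve_left two_ne_zero
  · simp only [hw, false_and, iff_false]
    intro h0
    push Not at hw
    obtain ⟨i, hi⟩ := hw
    rw [Finset.prod_eq_zero (Finset.mem_univ i) (by rw [hi, sub_self])] at hcard
    -- At an atom the (1, 1) solution vanishes at step n. If the (1, conj η) solution did too, the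
    -- two would be proportional at step n - 1, against the Wronskian. The argument stops at n - 1
    -- because the determinant of the last step need not be nonzero.
    have hW : ∀ k, k + 1 ≤ Fintype.card ι → (szego α w (1, 1) k).1 * (szego α w (1, conj η) k).2
        - (szego α w (1, conj η) k).1 * (szego α w (1, 1) k).2 ≠ 0 := by
      intro k hk
      induction k with
      | zero => simpa [szego, sub_eq_zero] using hη2
      | succ k ih =>
        rw [szego_wronskian]
        exact mul_ne_zero (mul_ne_zero hw0 (one_sub_atomVerblunsky_ne_zero hu hs hk))
          (ih (by omega))
    rw [hm, szego_succ_fst] at h0 hcard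
    have := hW m (by omega)
    apply this
    apply mul_left_cancel₀ hw0
    linear_combination (szego α w (1, conj η) m).2 * hcard - (szego α w (1, 1) m).2 * h0

/-- Replaces the chosen orthogonal polynomial by the one from the recursion, by uniqueness; the
latter is explicit and visibly measurable in the atoms and weights. -/
theorem verblunsky_eq (hu : Function.Injective u) (hs : ∀ i, 0 < s i) {k : ℕ}
    (hk : k < Fintype.card ι) :
    verblunsky (∑ i, ENNReal.ofReal (s i) • Measure.dirac (u i)) k =
      atomVerblunsky (fun i => (u i : ℂ)) s k := by
  set μ : Measure Circle := ∑ i, ENNReal.ofReal (s i) • Measure.dirac (u i)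
  set α := atomVerblunsky (fun i => (u i : ℂ)) s
  have hint : ∀ f : Circle → ℂ, ∫ z, f z ∂μ = ∑ i, s i * f (u i) := by
    intro f
    rw [integral_finsetSum_measure]
    · refine Finset.sum_congr rfl fun i _ => ?_
      rw [integral_smul_measure, integral_dirac, ENNReal.toReal_ofReal (hs i).le]
      simp
    · intro i _
      exact (integrable_dirac (by simp)).smul_measure (by simp)
  have ⟨hm, hd, _⟩ := szegoPoly_monic α (k + 1)
  have hA : IsMonicOrthogonal μ (k + 1) (szegoPoly α (k + 1)).1 := by
    refine ⟨hm, hd, fun j hj => ?_⟩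
    rw [hint]
    simp only [(eval_szegoPoly α _ _).1]
    exact szego_orthogonal hu hs hk j hj
  have H : ∃ Φ, IsMonicOrthogonal μ (k + 1) Φ := ⟨_, hA⟩
  have heq : H.choose = (szegoPoly α (k + 1)).1 := by
    obtain ⟨hm', hd', ho'⟩ := H.choose_spec
    rw [← sub_eq_zero]
    refine eq_zero_of_orthogonal hu hs (m := k + 1) hk (hm'.degree_sub_lt hm hd' hd) ?_
    · intro j hj
      have h1 := ho' j hj
      have h2 := hA.2.2 j hj
      rw [hint] at h1 h2
      simp only [Polynomial.eval_sub, mul_sub, Finset.sum_sub_distrib]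
      rw [h1, h2, sub_zero]
  rw [verblunsky, dif_pos H, heq, (eval_szegoPoly α _ _).1, szego_succ_fst, szego_zero_snd]
  simp

end Atoms

/-! ### Counting points of periodic sets -/

section PeriodicSet

variable {Z : Set ℝ} {p : ℝ}

theorem mem_add_int_mul_iff (hZ : ∀ x, x + p ∈ Z ↔ x ∈ Z) (x : ℝ) (m : ℤ) :
    x + m * p ∈ Z ↔ x ∈ Z := by
  induction m with
  | zero => simp
  | succ m ih =>
    rw [← ih, ← hZ (x + ((m : ℤ) : ℝ) * p)]
    push_cast
    ring_nf
  | pred m ih =>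
    rw [← ih, ← hZ (x + ((-(m : ℤ) - 1 : ℤ) : ℝ) * p)]
    push_cast
    ring_nf

theorem inter_Ico_image (hZ : ∀ x, x + p ∈ Z ↔ x ∈ Z) (a b : ℝ) (m : ℤ) :
    Z ∩ Ico (a + m * p) (b + m * p) = (fun x => x + m * p) '' (Z ∩ Ico a b) := by
  ext x
  constructor
  · rintro ⟨h, h1, h2⟩
    refine ⟨x - m * p, ⟨?_, by linarith, by linarith⟩, by ring⟩
    rw [← mem_add_int_mul_iff hZ _ m]
    simpa using h
  · rintro ⟨y, ⟨h, h1, h2⟩, rfl⟩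
    exact ⟨(mem_add_int_mul_iff hZ _ _).2 h, by simpa using h1, by simpa using h2⟩

theorem finite_ncard_inter_Ico (hZ : ∀ x, x + p ∈ Z ↔ x ∈ Z) (hp : 0 < p)
    (hfin : (Z ∩ Ico 0 p).Finite) (k : ℤ) (m : ℕ) :
    (Z ∩ Ico (k * p) (k * p + m * p)).Finite ∧
      (Z ∩ Ico (k * p) (k * p + m * p)).ncard = m * (Z ∩ Ico 0 p).ncard := by
  induction m with
  | zero => simp
  | succ m ih =>
    have hsplit : Z ∩ Ico (k * p) (k * p + (m + 1 : ℕ) * p) =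
        (Z ∩ Ico (k * p) (k * p + m * p)) ∪
          (Z ∩ Ico (0 + ((k + m : ℤ) : ℝ) * p) (p + ((k + m : ℤ) : ℝ) * p)) := by
      rw [← inter_union_distrib_left]
      congr 1
      have h1 : 0 + ((k + m : ℤ) : ℝ) * p = k * p + m * p := by push_cast; ring
      have h2 : p + ((k + m : ℤ) : ℝ) * p = k * p + (m + 1 : ℕ) * p := by push_cast; ring
      rw [h1, h2, Ico_union_Ico_eq_Ico]
      · have : 0 ≤ (m : ℝ) * p := by positivity
        linarith
      · push_cast; linarith
    have hinj : Function.Injective (fun x : ℝ => x + ((k + m : ℤ) : ℝ) * p) :=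
      add_left_injective _
    have hfin' : (Z ∩ Ico (0 + ((k + m : ℤ) : ℝ) * p) (p + ((k + m : ℤ) : ℝ) * p)).Finite := by
      rw [inter_Ico_image hZ]; exact hfin.image _
    rw [hsplit]
    refine ⟨ih.1.union hfin', ?_⟩
    rw [ncard_union_eq ?_ ih.1 hfin', ih.2, inter_Ico_image hZ, ncard_image_of_injective _ hinj]
    · ring
    · rw [Set.disjoint_left]
      rintro x ⟨-, -, h1⟩ ⟨-, h2, -⟩
      push_cast at h2
      linarith

/-- The number of points of a periodic set in `[0, y]` and in `[-y, 0]`. -/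
theorem abs_ncard_sub_le (hZ : ∀ x, x + p ∈ Z ↔ x ∈ Z) (hp : 0 < p)
    (hfin : (Z ∩ Ico 0 p).Finite) {y : ℝ} (hy : 0 ≤ y) :
    |((Z ∩ Icc 0 y).ncard : ℝ) - (Z ∩ Ico 0 p).ncard * (y / p)| ≤ 2 * (Z ∩ Ico 0 p).ncard ∧
      |((Z ∩ Icc (-y) 0).ncard : ℝ) - (Z ∩ Ico 0 p).ncard * (y / p)| ≤
        2 * (Z ∩ Ico 0 p).ncard := by
  set N := (Z ∩ Ico 0 p).ncard
  set m := ⌊y / p⌋₊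
  have h1 : (m : ℝ) ≤ y / p := Nat.floor_le (by positivity)
  have h2 : y / p < m + 1 := Nat.lt_floor_add_one _
  have h1' : m * p ≤ y := (le_div_iff₀ hp).1 h1
  have h2' : y < (m + 1) * p := (div_lt_iff₀ hp).1 h2
  have hN : (0 : ℝ) ≤ N := Nat.cast_nonneg _
  -- Sandwich between m = ⌊y/p⌋ and m + 2 whole periods. The window [-y, 0] needs two extra
  -- half-open periods, because one containing the right endpoint 0 must be added.
  have key : ∀ {A B C : Set ℝ}, A ⊆ B → B ⊆ C → (Z ∩ A).ncard = m * N →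
      (Z ∩ C).Finite → (Z ∩ C).ncard = (m + 2) * N →
      |((Z ∩ B).ncard : ℝ) - N * (y / p)| ≤ 2 * N := by
    intro A B C hAB hBC hA hCf hC
    have hBf : (Z ∩ B).Finite := hCf.subset (inter_subset_inter_right _ hBC)
    have e1 := ncard_le_ncard (inter_subset_inter_right Z hAB) hBf
    have e2 := ncard_le_ncard (inter_subset_inter_right Z hBC) hCf
    rw [hA] at e1
    rw [hC] at e2
    have e1' : (m : ℝ) * N ≤ (Z ∩ B).ncard := by exact_mod_cast e1
    have e2' : ((Z ∩ B).ncard : ℝ) ≤ (m + 2) * N := by exact_mod_cast e2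
    have e3 := mul_le_mul_of_nonneg_left h1 hN
    have e4 := mul_le_mul_of_nonneg_left h2.le hN
    rw [abs_le]
    constructor <;> nlinarith
  have c1 := finite_ncard_inter_Ico hZ hp hfin
  constructor
  · refine key (A := Ico ((0 : ℤ) * p) ((0 : ℤ) * p + m * p))
      (C := Ico ((0 : ℤ) * p) ((0 : ℤ) * p + (m + 2 : ℕ) * p)) ?_ ?_ (c1 _ _).2 (c1 _ _).1
      (c1 _ _).2
    · rintro x ⟨h3, h4⟩
      push_cast at h3 h4
      exact ⟨by linarith, by linarith⟩
    · rintro x ⟨h3, h4⟩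
      push_cast
      exact ⟨by linarith, by linarith⟩
  · refine key (A := Ico ((-m : ℤ) * p) ((-m : ℤ) * p + m * p))
      (C := Ico ((-(m + 1) : ℤ) * p) ((-(m + 1) : ℤ) * p + (m + 2 : ℕ) * p)) ?_ ?_ (c1 _ _).2
      (c1 _ _).1 (c1 _ _).2
    · rintro x ⟨h3, h4⟩
      push_cast at h3 h4
      exact ⟨by linarith, by linarith⟩
    · rintro x ⟨h3, h4⟩
      push_cast
      exact ⟨by linarith, by linarith⟩

theorem finite_inter_Icc_of_periodic (hZ : ∀ x, x + p ∈ Z ↔ x ∈ Z) (hp : 0 < p)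
    (hfin : (Z ∩ Ico 0 p).Finite) (a b : ℝ) : (Z ∩ Icc a b).Finite := by
  obtain ⟨m, hm⟩ := exists_nat_gt (max (-a / p) (b / p))
  have h1 : -a < m * p := (div_lt_iff₀ hp).1 ((le_max_left _ _).trans_lt hm)
  have h2 : b < m * p := (div_lt_iff₀ hp).1 ((le_max_right _ _).trans_lt hm)
  refine (finite_ncard_inter_Ico hZ hp hfin (-m) (2 * m)).1.subset ?_
  rintro x ⟨hx, h3, h4⟩
  refine ⟨hx, ?_, ?_⟩ <;> push_cast <;> linarith

/-- For a periodic set the two counts in the definition of a point set differ by a bounded amount,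
which this bound absorbs. -/
theorem one_isBigO_div_log_sq :
    (fun _ : ℝ => (1 : ℝ)) =O[atTop] (fun x : ℝ => x / Real.log x ^ 2) := by
  have h : (fun x : ℝ => Real.log x ^ 2) =o[atTop] (id : ℝ → ℝ) 
    := Real.isLittleO_pow_log_id_atTop
  refine IsBigO.of_bound 1 ?_
  filter_upwards [h.bound one_pos, eventually_gt_atTop (1 : ℝ)] with x hx hx1
  have hl : 0 < Real.log x := Real.log_pos hx1
  have hx0 : 0 < x := by linarith
  rw [Real.norm_of_nonneg (by positivity), id, Real.norm_of_nonneg hx0.le, one_mul] at hx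
  rw [norm_one, one_mul, Real.norm_of_nonneg (by positivity), le_div_iff₀ (by positivity), one_mul]
  exact hx

theorem isPointSet_of_periodic (hZ : ∀ x, x + p ∈ Z ↔ x ∈ Z) (hp : 0 < p)
    (hfin : (Z ∩ Ico 0 p).Finite) {x₀ : ℝ} (hx₀ : x₀ ∈ Z) : IsPointSet Z where
  finite_inter_Icc := finite_inter_Icc_of_periodic hZ hp hfin
  not_bddAbove := by
    rintro ⟨B, hB⟩
    obtain ⟨m, hm⟩ := exists_nat_gt ((B - x₀) / p)
    have := hB ((mem_add_int_mul_iff hZ x₀ m).2 hx₀)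
    rw [div_lt_iff₀ hp] at hm
    push_cast at this
    linarith
  not_bddBelow := by
    rintro ⟨B, hB⟩
    obtain ⟨m, hm⟩ := exists_nat_gt ((x₀ - B) / p)
    have := hB ((mem_add_int_mul_iff hZ x₀ (-m)).2 hx₀)
    rw [div_lt_iff₀ hp] at hm
    push_cast at this
    linarith
  card_isBigO := by
    set N : ℝ := ((Z ∩ Ico 0 p).ncard : ℝ)
    have hN : 0 ≤ N := Nat.cast_nonneg _
    refine IsBigO.of_bound (2 * N + N / p) ?_
    filter_upwards [eventually_ge_atTop (1 : ℝ)] with x hx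
    have h := (abs_le.1 (abs_ncard_sub_le hZ hp hfin (y := x) (by linarith)).1).2
    rw [Real.norm_of_nonneg (Nat.cast_nonneg _), Real.norm_of_nonneg (by linarith)]
    have h1 : N * (x / p) = N / p * x := by ring
    nlinarith
  card_sub_card_isBigO a b := by
    refine IsBigO.trans ?_ one_isBigO_div_log_sq
    set N : ℝ := ((Z ∩ Ico 0 p).ncard : ℝ) with hNdef
    refine IsBigO.of_bound (4 * N + N * (|a + b| / p)) ?_
    filter_upwards [eventually_ge_atTop (-a), eventually_ge_atTop b] with x h1 h2
    have e1 := abs_le.1 (abs_ncard_sub_le hZ hp hfin (y := x + a) (by linarith)).1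
    have e2 := abs_le.1 (abs_ncard_sub_le hZ hp hfin (y := x - b) (by linarith)).2
    rw [show -(x - b) = -x + b by ring, ← hNdef] at e2
    rw [← hNdef] at e1
    have e3 : N * ((x + a) / p) - N * ((x - b) / p) = N * ((a + b) / p) := by ring
    have e4 : |N * ((a + b) / p)| = N * (|a + b| / p) := by
      rw [abs_mul, abs_div, abs_of_pos hp, abs_of_nonneg (Nat.cast_nonneg _)]
    have e5 := abs_le.1 e4.le
    rw [norm_one, mul_one, Real.norm_eq_abs, abs_le]
    constructor <;> linarith [e1.1, e1.2, e2.1, e2.2, e5.1, e5.2]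

end PeriodicSet

/-! ### Labels of periodic point sets and their images on the circle -/

section Labeling

theorem label_nonneg_iff (L : PointSet) (j : ℤ) : 0 ≤ L.label j ↔ 0 ≤ j := by
  have h := L.isLabeling_label
  constructor
  · intro hj
    by_contra! H
    have := h.strictMono.monotone (show j ≤ -1 by omega)
    linarith [h.neg_one_neg]
  · intro hj
    exact h.zero_nonneg.trans (h.strictMono.monotone hj)

theorem mem_carrier_iff (L : PointSet) (x : ℝ) : x ∈ L.carrier ↔ ∃ j, L.label j = x := by
  rw [← L.isLabeling_label.range_eq]; rfl

/-- Nonnegative points of `L` below `x` are the first `Card (L ∩ [0, x))` labels. -/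
theorem label_lt_iff (L : PointSet) (x : ℝ) {j : ℤ} (hj : 0 ≤ j) :
    L.label j < x ↔ j < (L.carrier ∩ Ico 0 x).ncard := by
  have h := L.isLabeling_label
  have hfin : (L.carrier ∩ Ico 0 x).Finite :=
    (L.isPointSet.finite_inter_Icc 0 x).subset (inter_subset_inter_right _ Ico_subset_Icc_self)
  have hcard : ∀ a : ℤ, 0 ≤ a → ((L.label '' Ico 0 a).ncard : ℤ) = a := by
    intro a ha
    rw [ncard_image_of_injective _ h.strictMono.injective, ← Finset.coe_Ico, ncard_coe_finset]
    simp [ha]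
  constructor
  · intro hx
    have hsub : L.label '' Ico 0 (j + 1) ⊆ L.carrier ∩ Ico 0 x := by
      rintro _ ⟨i, hi, rfl⟩
      refine ⟨(mem_carrier_iff L _).2 ⟨i, rfl⟩, (label_nonneg_iff L i).2 hi.1, ?_⟩
      exact (h.strictMono.monotone (Int.lt_add_one_iff.1 hi.2)).trans_lt hx
    have h1 := ncard_le_ncard hsub hfin
    have h2 := hcard (j + 1) (by omega)
    omega
  · intro hc
    by_contra! hx
    have hsub : L.carrier ∩ Ico 0 x ⊆ L.label '' Ico 0 j := by
      rintro y ⟨hy, hy0, hyx⟩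
      obtain ⟨i, rfl⟩ := (mem_carrier_iff L _).1 hy
      refine ⟨i, ⟨(label_nonneg_iff L i).1 hy0, ?_⟩, rfl⟩
      exact h.strictMono.lt_iff_lt.1 (hyx.trans_le hx)
    have h1 := ncard_le_ncard hsub ((finite_Ico 0 j).image _)
    have h2 := hcard j hj
    omega

variable {n : ℕ} {L : PointSet}

/-- Shifting both the index by n and the values by 2πn gives a labeling of the same set, and
labelings are unique. The normalization at 0 holds because exactly n points lie in [0, 2πn). -/
theorem label_add (hL : L.IsPeriodic n) (j : ℤ) :
    L.label (j + n) = L.label j + 2 * Real.pi * n := by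
  have h := L.isLabeling_label
  have hlt : ∀ {j : ℤ}, 0 ≤ j → (L.label j < 2 * Real.pi * n ↔ j < n) := fun {j} hj => by
    rw [label_lt_iff L _ hj, hL.2]
  have hpos : (0 : ℝ) ≤ 2 * Real.pi * n := by positivity
  have h' : IsLabeling L.carrier (fun j => L.label (j + n) - 2 * Real.pi * n) := by
    refine ⟨fun i j hij => sub_lt_sub_right (h.strictMono (by omega)) _, ?_, ?_, ?_⟩
    · ext x
      rw [← hL.1, mem_carrier_iff]
      constructor
      · rintro ⟨j, rfl⟩
        exact ⟨j + n, by ring⟩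
      · rintro ⟨j, hj⟩
        exact ⟨j - n, by simp [hj]⟩
    · rcases Nat.eq_zero_or_pos n with rfl | hn
      · simpa using h.neg_one_neg
      · rw [sub_neg]
        exact (hlt (by omega)).2 (by omega)
    · have := (hlt (j := (0 : ℤ) + n) (by omega)).not.2 (by omega)
      linarith
  have := congrFun (h.unique h') j
  linarith

theorem label_add_mul (hL : L.IsPeriodic n) (j m : ℤ) :
    L.label (j + m * n) = L.label j + m * (2 * Real.pi * n) := by
  induction m with
  | zero => simp
  | succ m ih =>
    rw [show j + ((m : ℤ) + 1) * n = j + m * n + n by ring, label_add hL, ih]; push_cast; ring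
  | pred m ih =>
    have := label_add hL (j + (-(m : ℤ) - 1) * n)
    rw [show j + (-(m : ℤ) - 1) * n + n = j + -m * n by ring, ih] at this
    push_cast at this ⊢
    linarith

theorem label_fin_mem (hL : L.IsPeriodic n) (i : Fin n) :
    L.label (i : ℤ) ∈ Ico 0 (2 * Real.pi * n) := by
  refine ⟨(label_nonneg_iff L _).2 (by omega), ?_⟩
  rw [label_lt_iff L _ (by omega), hL.2]
  exact_mod_cast i.2

theorem circlePoint_injective (hL : L.IsPeriodic n) : Function.Injective (circlePoint n L) := by
  intro i j hij
  have hn : (0 : ℝ) < n := by exact_mod_cast i.pos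
  have hi := label_fin_mem hL i
  have hj := label_fin_mem hL j
  have h : L.label (i : ℤ) / n = L.label (j : ℤ) / n := by
    refine Circle.exp_injOn_Ico (a := 0) (b := 2 * Real.pi) (by simp) ?_ ?_ hij
    · exact ⟨div_nonneg hi.1 hn.le, by rw [div_lt_iff₀ hn]; exact hi.2⟩
    · exact ⟨div_nonneg hj.1 hn.le, by rw [div_lt_iff₀ hn]; exact hj.2⟩
  rw [div_left_inj' hn.ne'] at h
  have := L.isLabeling_label.strictMono.injective h
  exact Fin.ext (by exact_mod_cast this)

theorem carrier_eq (hn : 1 ≤ n) (hL : L.IsPeriodic n) :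
    L.carrier = {x : ℝ | Circle.exp (x / n) ∈ range (circlePoint n L)} := by
  have hn' : (n : ℝ) ≠ 0 := by positivity
  have key : ∀ x y : ℝ, Circle.exp (x / n) = Circle.exp (y / n) ↔
      ∃ m : ℤ, x = y + m * (2 * Real.pi * n) := by
    intro x y
    rw [Circle.exp_eq_exp]
    refine exists_congr fun m => ?_
    field_simp
  ext x
  constructor
  · intro hx
    obtain ⟨j, rfl⟩ := (mem_carrier_iff L x).1 hx
    have hmod : 0 ≤ j % n := Int.emod_nonneg _ (by omega)
    have hmod' : j % n < n := Int.emod_lt_of_pos _ (by omega)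
    refine ⟨⟨(j % n).toNat, by omega⟩, ?_⟩
    rw [circlePoint, eq_comm, key]
    refine ⟨j / n, ?_⟩
    rw [← label_add_mul hL]
    congr 1
    simp only [Int.toNat_of_nonneg hmod]
    rw [mul_comm, Int.emod_add_mul_ediv]
  · rintro ⟨i, hi⟩
    rw [circlePoint, eq_comm, key] at hi
    obtain ⟨m, rfl⟩ := hi
    rw [mem_add_int_mul_iff hL.1]
    exact (mem_carrier_iff L _).2 ⟨_, rfl⟩

theorem exists_strictMono_arg (hn : 1 ≤ n) (hL : L.IsPeriodic n) :
    ∃ θ : Fin n → ℝ, StrictMono θ ∧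
      ∀ i, θ i ∈ Ico 0 (2 * Real.pi) ∧ circlePoint n L i = Circle.exp (θ i) := by
  have hn' : (0 : ℝ) < n := by positivity
  refine ⟨fun i => L.label (i : ℤ) / n, fun i j hij => ?_, fun i => ⟨⟨?_, ?_⟩, rfl⟩⟩
  · exact div_lt_div_of_pos_right (L.isLabeling_label.strictMono (by simpa using hij)) hn'
  · exact div_nonneg (label_fin_mem hL i).1 hn'.le
  · rw [div_lt_iff₀ hn']
    exact (label_fin_mem hL i).2

theorem circleMeasure_isProbabilityMeasure (hn : 1 ≤ n) (L : PointSet) {γ : ℤ → ℝ}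
    (hpos : ∀ j, 0 < γ j) (hper : ∀ j : ℤ, γ (j + n) = γ j)
    (hsum : ∑ i : Fin n, γ (i : ℤ) = 2 * (n : ℝ)) :
    IsProbabilityMeasure (circleMeasure n L γ) := by
  have hn' : (0 : ℝ) < n := by positivity
  -- The shifted window trades γ_0 for γ_n, which are equal by periodicity.
  have h1 : ∑ i : Fin n, γ ((i : ℤ) + 1) = 2 * (n : ℝ) := by
    rw [← hsum, Fin.sum_univ_eq_sum_range (fun i : ℕ => γ ((i : ℤ) + 1)),
      Fin.sum_univ_eq_sum_range (fun i : ℕ => γ (i : ℤ))]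
    have e1 := Finset.sum_range_succ (fun i : ℕ => γ (i : ℤ)) n
    have e2 := Finset.sum_range_succ' (fun i : ℕ => γ (i : ℤ)) n
    have e3 := hper 0
    push_cast at e1 e2
    rw [zero_add] at e3
    linarith
  have h2 : ∑ i : Fin n, γ ((i : ℤ) + 1) / (2 * n) = 1 := by
    rw [← Finset.sum_div, h1, div_self (by positivity)]
  refine ⟨?_⟩
  rw [circleMeasure, Measure.finsetSum_apply]
  simp only [Measure.smul_apply, measure_univ, smul_eq_mul, mul_one]
  rw [← ENNReal.ofReal_sum_of_nonneg fun i _ => div_nonneg (hpos _).le (by positivity), h2,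
    ENNReal.ofReal_one]

end Labeling

/-! ### The cotangent series over asymmetric windows -/

section Cotangent

theorem tendsto_symmetric_cot {t : ℂ} (ht : t ∈ Complex.integerComplement) :
    Tendsto (fun M : ℕ => ∑ m ∈ Finset.Icc (-M : ℤ) M, 1 / (t + m)) atTop
      (𝓝 (Real.pi * Complex.cot (Real.pi * t))) := by
  have h := (tendsto_logDeriv_euler_cot_sub ht).add_const (1 / t)
  rw [sub_add_cancel] at h
  refine h.congr fun M => ?_
  induction M with
  | zero => simp
  | succ M ih =>
    rw [Nat.cast_add, Nat.cast_one, Finset.Icc_succ_succ, Finset.sum_union (by simp),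
      Finset.sum_pair (by lia), ← ih, Finset.sum_range_succ, cotTerm]
    push_cast
    ring

theorem tendsto_one_div_add {t : ℂ} :
    Tendsto (fun M : ℕ => 1 / (t + M)) atTop (𝓝 0) ∧
      Tendsto (fun M : ℕ => 1 / (t - (M + 1))) atTop (𝓝 0) := by
  have h : Tendsto (fun M : ℕ => (M : ℂ)) atTop (Bornology.cobounded ℂ) :=
    tendsto_norm_atTop_iff_cobounded.1 (by simpa using tendsto_natCast_atTop_atTop (R := ℝ))
  constructor
  · simp only [one_div]
    exact tendsto_inv₀_cobounded.comp ((tendsto_const_add_cobounded t).comp h)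
  · simp only [one_div]
    refine tendsto_inv₀_cobounded.comp ?_
    have := (tendsto_const_sub_cobounded (t - 1)).comp h
    refine this.congr fun M => ?_
    simp only [Function.comp_apply]
    ring

/-- The cotangent series, summed over slightly asymmetric windows. -/
theorem tendsto_window_cot {t : ℂ} (ht : t ∈ Complex.integerComplement) {r : ℝ}
    (hr : r ∈ Ico (0 : ℝ) 1) :
    Tendsto (fun c : ℝ => ∑ m ∈ Finset.Icc (-⌊c + r⌋) ⌊c - r⌋, 1 / (t + m)) atTop
      (𝓝 (Real.pi * Complex.cot (Real.pi * t))) := by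
  have h0 := (tendsto_symmetric_cot ht).comp (tendsto_nat_floor_atTop (α := ℝ))
  -- As 0 ≤ r < 1, the window differs from [-⌊c⌋, ⌊c⌋] by at most one extra index at the left end
  -- and one missing index at the right end; each of these terms tends to 0.
  have h1 : Tendsto (fun c : ℝ => if ⌊c + r⌋ = ⌊c⌋₊ then 0 else 1 / (t - (⌊c⌋₊ + 1))) atTop
      (𝓝 0) := by
    have h := ((tendsto_one_div_add (t := t)).2.comp (tendsto_nat_floor_atTop (α := ℝ))).norm
    rw [norm_zero] at h
    refine squeeze_zero_norm (fun c => ?_) h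
    split_ifs
    · simpa only [norm_zero] using norm_nonneg _
    · exact le_rfl
  have h2 : Tendsto (fun c : ℝ => if ⌊c - r⌋ = ⌊c⌋₊ then 0 else 1 / (t + ⌊c⌋₊)) atTop
      (𝓝 0) := by
    have h := ((tendsto_one_div_add (t := t)).1.comp (tendsto_nat_floor_atTop (α := ℝ))).norm
    rw [norm_zero] at h
    refine squeeze_zero_norm (fun c => ?_) h
    split_ifs
    · simpa only [norm_zero] using norm_nonneg _
    · exact le_rfl
  have h3 := (h0.add h1).sub h2
  rw [add_zero, sub_zero] at h3
  refine h3.congr' ?_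
  filter_upwards [eventually_ge_atTop (1 : ℝ)] with c hc
  have hf : ((⌊c⌋₊ : ℕ) : ℤ) = ⌊c⌋ := Int.natCast_floor_eq_floor (by linarith)
  have e1 := Int.floor_le c
  have e2 := Int.lt_floor_add_one c
  have hM : 1 ≤ ⌊c⌋₊ := (Nat.one_le_floor_iff c).2 hc
  have c1 : ⌊c + r⌋ = ⌊c⌋₊ ∨ ⌊c + r⌋ = ⌊c⌋₊ + 1 := by
    rw [hf]
    have : ⌊c⌋ ≤ ⌊c + r⌋ := Int.floor_mono (by linarith [hr.1])
    have : ⌊c + r⌋ < ⌊c⌋ + 2 := Int.floor_lt.2 (by push_cast; linarith [hr.2])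
    omega
  have c2 : ⌊c - r⌋ = ⌊c⌋₊ ∨ ⌊c - r⌋ = ⌊c⌋₊ - 1 := by
    rw [hf]
    have : ⌊c - r⌋ ≤ ⌊c⌋ := Int.floor_mono (by linarith [hr.1])
    have : ⌊c⌋ - 1 ≤ ⌊c - r⌋ := Int.le_floor.2 (by push_cast; linarith [hr.2])
    omega
  set M := ⌊c⌋₊
  have s1 : ∀ b : ℤ, -(M : ℤ) ≤ b → ∑ m ∈ Finset.Icc (-(M + 1) : ℤ) b, 1 / (t + (m : ℂ)) =
      ∑ m ∈ Finset.Icc (-M : ℤ) b, 1 / (t + (m : ℂ)) + 1 / (t - (M + 1)) := by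
    intro b hb
    have : Finset.Icc (-(M + 1) : ℤ) b = insert (-(M + 1) : ℤ) (Finset.Icc (-M : ℤ) b) := by
      ext; simp; omega
    rw [this, Finset.sum_insert (by simp)]
    push_cast
    ring
  have s2 : ∑ m ∈ Finset.Icc (-M : ℤ) (M - 1), 1 / (t + (m : ℂ)) =
      ∑ m ∈ Finset.Icc (-M : ℤ) M, 1 / (t + (m : ℂ)) - 1 / (t + M) := by
    have : Finset.Icc (-M : ℤ) M = insert (M : ℤ) (Finset.Icc (-M : ℤ) (M - 1)) := by
      ext; simp; omega
    rw [this, Finset.sum_insert (by simp)]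
    push_cast
    ring
  rcases c1 with h | h <;> rcases c2 with h' | h' <;>
    simp only [Function.comp_apply, h, h', if_true]
  · ring
  · rw [if_neg (by omega), s2]; ring
  · rw [if_neg (by omega), s1 _ (by omega)]; ring
  · rw [if_neg (by omega), if_neg (by omega), s1 _ (by omega), s2]; ring

end Cotangent

/-! ### Stieltjes level sets as zeros for rotated Verblunsky coefficients -/

section Periodic

variable {n : ℕ} {L : PointSet} {γ : ℤ → ℝ}

/-- Labels are split as i + mn. The truncation |λ| ≤ c then becomes, in each class, a window in m
shifted by the phase λ_i/(2πn); hence the asymmetric windows. -/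
theorem truncatedStieltjes_eq_sum (hn : 1 ≤ n) (hL : L.IsPeriodic n)
    (hγ : ∀ j : ℤ, γ (j + n) = γ j) (c : ℝ) (z : ℂ) :
    truncatedStieltjes L γ c z = ∑ i : Fin n,
      ∑ m ∈ Finset.Icc (-⌊c / (2 * Real.pi * n) + L.label (i : ℤ) / (2 * Real.pi * n)⌋)
        ⌊c / (2 * Real.pi * n) - L.label (i : ℤ) / (2 * Real.pi * n)⌋,
        (γ (i : ℤ) / (2 * Real.pi * n) : ℂ) *
          (1 / (((L.label (i : ℤ) : ℂ) - z) / (2 * Real.pi * n) + m)) := by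
  have _ : NeZero n := ⟨by omega⟩
  have hp : (0 : ℝ) < 2 * Real.pi * n := by positivity
  have hpc : (2 * Real.pi * n : ℂ) ≠ 0 := by exact_mod_cast hp.ne'
  have hγm : ∀ j m : ℤ, γ (j + m * n) = γ j := by
    intro j m
    induction m with
    | zero => simp
    | succ m ih => rw [← ih, ← hγ (j + m * n)]; ring_nf
    | pred m ih => rw [← ih, ← hγ (j + (-(m : ℤ) - 1) * n)]; ring_nf
  set g : ℤ → ℂ := fun j => ∑ᶠ (_ : L.label j ∈ Icc (-c) c), (γ j : ℂ) / ((L.label j : ℂ) - z)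
    with hg
  have hgfin : g.support.Finite := by
    refine Finite.subset ((L.isPointSet.finite_inter_Icc (-c) c).preimage
      (f := L.label) L.isLabeling_label.strictMono.injective.injOn) ?_
    intro j hj
    by_contra hj'
    refine hj ?_
    have : L.label j ∉ Icc (-c) c := fun h => hj' ⟨(mem_carrier_iff L _).2 ⟨j, rfl⟩, h⟩
    have _ := isEmpty_Prop.2 this
    exact finsum_of_isEmpty _
  have e1 : truncatedStieltjes L γ c z = ∑ᶠ j, g j := rfl
  set e : Fin n × ℤ ≃ ℤ := (Equiv.prodComm _ _).trans (Int.divModEquiv n).symm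
  have he : ∀ i m, e (i, m) = (i : ℤ) + m * n := fun i m => by
    simp [e, Int.divModEquiv, add_comm]
  rw [e1, ← finsum_comp_equiv e, finsum_curry, finsum_eq_sum_of_fintype]
  · refine Finset.sum_congr rfl fun i _ => ?_
    rw [← finsum_mem_finset_eq_sum]
    refine finsum_congr fun m => ?_
    rw [he, hg]
    simp only [label_add_mul hL, hγm]
    refine finsum_congr_Prop ?_ fun _ => ?_
    · rw [Finset.mem_Icc, mem_Icc, neg_le (α := ℤ), Int.le_floor, Int.le_floor, ← add_div, ← sub_div,
        le_div_iff₀ hp, le_div_iff₀ hp, eq_iff_iff]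
      push_cast
      constructor <;> rintro ⟨h1, h2⟩ <;> constructor <;> linarith
    · push_cast
      rw [div_mul_div_comm, mul_one, mul_add, mul_div_cancel₀ _ hpc]
      ring_nf
  · exact hgfin.preimage e.injective.injOn

/-- Each residue class sums to a cotangent of (λ_i - x)/(2n), and cot((a - b)/2) = i (e^{ia} +
e^{ib})/(e^{ia} - e^{ib}). -/
theorem tendsto_truncatedStieltjes (hn : 1 ≤ n) (hL : L.IsPeriodic n)
    (hγ : ∀ j : ℤ, γ (j + n) = γ j) {x : ℝ} (hx : x ∉ L.carrier) :
    Tendsto (fun c : ℝ => truncatedStieltjes L γ c x) atTop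
      (𝓝 (Complex.I * caratheodory (circlePoint n L) (fun i => γ (i : ℤ) / (2 * n))
        (Circle.exp (x / n)))) := by
  have hn0 : (n : ℂ) ≠ 0 := by exact_mod_cast (by omega : n ≠ 0)
  have hp : (0 : ℝ) < 2 * Real.pi * n := by positivity
  have hpi : (Real.pi : ℂ) ≠ 0 := by exact_mod_cast Real.pi_ne_zero
  simp only [truncatedStieltjes_eq_sum hn hL hγ, ← Finset.mul_sum]
  have hlim : Complex.I * caratheodory (circlePoint n L) (fun i => γ (i : ℤ) / (2 * n))
      (Circle.exp (x / n)) = ∑ i : Fin n, (γ (i : ℤ) / (2 * Real.pi * n) : ℂ) *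
        (Real.pi * Complex.cot (Real.pi * (((L.label (i : ℤ) : ℂ) - x) / (2 * Real.pi * n)))) := by
    rw [caratheodory, Finset.mul_sum]
    refine Finset.sum_congr rfl fun i _ => ?_
    have hne : (circlePoint n L i : ℂ) ≠ Circle.exp (x / n) := by
      intro h
      apply hx
      rw [carrier_eq hn hL]
      exact ⟨i, Circle.ext h⟩
    have hexp : Complex.exp (2 * Complex.I *
        (Real.pi * (((L.label (i : ℤ) : ℂ) - x) / (2 * Real.pi * n)))) =
        circlePoint n L i / Circle.exp (x / n) := by
      rw [circlePoint, Circle.coe_exp, Circle.coe_exp, ← Complex.exp_sub]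
      congr 1
      push_cast
      field_simp
    rw [Complex.cot_eq_exp_ratio, hexp]
    have h1 := sub_ne_zero.2 hne
    have h2 := sub_ne_zero.2 hne.symm
    have h3 : (Circle.exp (x / n) : ℂ) ≠ 0 := Circle.coe_ne_zero _
    have h4 : (1 - (circlePoint n L i : ℂ) / Circle.exp (x / n)) ≠ 0 := by
      rw [one_sub_div h3]; exact div_ne_zero h2 h3
    set a : ℂ := (circlePoint n L i : ℂ)
    set b : ℂ := (Circle.exp (x / n) : ℂ)
    have h5 : (a / b + 1) / (Complex.I * (1 - a / b)) = Complex.I * ((a + b) / (a - b)) := by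
      rw [div_eq_iff (mul_ne_zero Complex.I_ne_zero h4)]
      field_simp
      linear_combination (a + b) * (a - b) * Complex.I_sq
    rw [h5]
    push_cast
    field_simp
  rw [hlim]
  refine tendsto_finsetSum _ fun i _ => Tendsto.const_mul _ ?_
  have hi := label_fin_mem hL i
  refine (tendsto_window_cot (r := L.label (i : ℤ) / (2 * Real.pi * n)) ?_ ?_).comp
    (tendsto_id.atTop_div_const hp)
  · rw [Complex.mem_integerComplement_iff]
    rintro ⟨m, hm⟩
    apply hx
    rw [eq_div_iff (by exact_mod_cast hp.ne')] at hm
    have hm' : (m : ℝ) * (2 * Real.pi * n) = L.label (i : ℤ) - x := by exact_mod_cast hm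
    rw [mem_carrier_iff]
    refine ⟨(i : ℤ) + (-m) * n, ?_⟩
    rw [label_add_mul hL]
    push_cast
    linarith
  · exact ⟨div_nonneg hi.1 hp.le, by rw [div_lt_one hp]; exact hi.2⟩

/-- The rotation of the Verblunsky coefficients that corresponds to the level `h`. -/
noncomputable def rotation (h : ℝ) : ℂ := (Complex.I * h - 1) / (Complex.I * h + 1)

theorem I_mul_add_one_ne_zero (h : ℝ) : Complex.I * h + 1 ≠ 0 := by
  intro H
  have := congrArg Complex.re H
  simp at this

theorem conj_rotation_mul (h : ℝ) : conj (rotation h) * rotation h = 1 := by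
  have h1 := I_mul_add_one_ne_zero h
  have h2 := I_mul_add_one_ne_zero (-h)
  push_cast at h2
  rw [rotation, map_div₀, map_sub, map_add, map_mul, Complex.conj_I, Complex.conj_ofReal, map_one]
  have h2' : -Complex.I * h + 1 ≠ 0 := by convert h2 using 1; ring
  rw [div_mul_div_comm, div_eq_one_iff_eq (mul_ne_zero h2' h1)]
  ring

theorem rotation_ne_one (h : ℝ) : rotation h ≠ 1 := by
  rw [rotation, Ne, div_eq_one_iff_eq (I_mul_add_one_ne_zero h)]
  intro H
  have := congrArg Complex.re H
  norm_num at this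

/-- The level condition is F = -ih, and conj η is the Cayley transform (F - 1)/(F + 1) of that
value. -/
theorem eq_level_iff (F : ℂ) (h : ℝ) :
    Complex.I * F = h ↔ F - 1 = conj (rotation h) * (F + 1) := by
  have h2 := I_mul_add_one_ne_zero (-h)
  push_cast at h2
  have h2' : -Complex.I * h + 1 ≠ 0 := by convert h2 using 1; ring
  rw [rotation, map_div₀, map_sub, map_add, map_mul, Complex.conj_I, Complex.conj_ofReal, map_one,
    div_mul_eq_mul_div, eq_div_iff h2']
  constructor
  · intro H
    have : F = -Complex.I * h := by linear_combination (-Complex.I) * H + F * Complex.I_sq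
    rw [this]
  · intro H
    linear_combination Complex.I / 2 * H - h * Complex.I_sq

theorem mem_levelSet_iff (hn : 1 ≤ n) (hL : L.IsPeriodic n) (hpos : ∀ j, 0 < γ j)
    (hγ : ∀ j : ℤ, γ (j + n) = γ j) (hsum : ∑ i : Fin n, γ (i : ℤ) = 2 * (n : ℝ)) (h x : ℝ) :
    x ∈ levelSet L γ h ↔ (szego (fun k => atomVerblunsky (fun i => (circlePoint n L i : ℂ))
      (fun i => γ (i : ℤ) / (2 * n)) k * rotation h) (Circle.exp (x / n)) (1, 1) n).1 = 0 := by
  have hn' : (0 : ℝ) < n := by positivity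
  have _ : Nonempty (Fin n) := ⟨⟨0, by omega⟩⟩
  have key := szego_rotate_eq_zero_iff (circlePoint_injective hL)
    (s := fun i : Fin n => γ (i : ℤ) / (2 * n))
    (fun i => div_pos (hpos _) (by positivity))
    (by rw [← Finset.sum_div, hsum, div_self (by positivity)])
    (conj_rotation_mul h) (rotation_ne_one h) (Circle.coe_ne_zero (Circle.exp (x / n)))
  rw [Fintype.card_fin] at key
  rw [key, ← eq_level_iff]
  have hmem : (∀ i, (circlePoint n L i : ℂ) ≠ Circle.exp (x / n)) ↔ x ∉ L.carrier := by
    rw [carrier_eq hn hL]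
    simp only [mem_ofPred_eq, mem_range, not_exists, ne_eq, Circle.ext_iff]
  have hmem' : (∀ y ∈ L.carrier, (x : ℂ) ≠ y) ↔ x ∉ L.carrier :=
    ⟨fun H hx => H x hx rfl, fun H y hy e => H (by rwa [Complex.ofReal_injective e])⟩
  rw [hmem]
  show _ ∧ _ ↔ _
  rw [hmem']
  refine and_congr_right fun hx => ?_
  have ht := tendsto_truncatedStieltjes hn hL hγ hx
  exact ⟨fun H => tendsto_nhds_unique ht H, fun H => H ▸ ht⟩

theorem mem_carrier_iff_szego (hn : 1 ≤ n) (hL : L.IsPeriodic n) {s : Fin n → ℝ}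
    (hs : ∀ i, 0 < s i) (x : ℝ) :
    x ∈ L.carrier ↔ (szego (atomVerblunsky (fun i => (circlePoint n L i : ℂ)) s)
      (Circle.exp (x / n)) (1, 1) n).1 = 0 := by
  have h := szego_card (circlePoint_injective hL) hs (Circle.exp (x / n))
  rw [Fintype.card_fin] at h
  rw [h, Finset.prod_eq_zero_iff, carrier_eq hn hL]
  simp only [mem_ofPred_eq, mem_range, Finset.mem_univ, true_and, sub_eq_zero, Circle.ext_iff]
  exact exists_congr fun i => eq_comm

end Periodic

/-! ### Measurability into and out of the space of point sets -/

section PointSetMeasurability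

theorem measurable_ncard_inter_Ioo (a b : ℝ) :
    Measurable fun L : PointSet => (L.carrier ∩ Ioo a b).ncard := by
  refine Measurable.of_comap_le ?_
  exact le_iSup₂ (f := fun a b : ℝ => MeasurableSpace.comap
    (fun L : PointSet => (L.carrier ∩ Ioo a b).ncard) inferInstance) a b

theorem measurable_pointSet {X : Type*} [MeasurableSpace X] {f : X → PointSet}
    (hf : ∀ a b : ℝ, Measurable fun x => ((f x).carrier ∩ Ioo a b).ncard) : Measurable f := by
  refine Measurable.of_le_map (iSup₂_le fun a b => ?_)
  rw [MeasurableSpace.comap_le_iff_le_map, MeasurableSpace.map_comp]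
  exact (hf a b).le_map

theorem measurable_label {j : ℤ} (hj : 0 ≤ j) : Measurable fun L : PointSet => L.label j := by
  refine measurable_of_Iio fun x => ?_
  -- The generators count points in open intervals, whereas [0, x) is half-open. As λ_{-1} < 0, the
  -- interval (-1/(m+1), x) contains no negative point of L once m is large.
  have : (fun L : PointSet => L.label j) ⁻¹' Iio x =
      ⋂ m : ℕ, {L : PointSet | j < (L.carrier ∩ Ioo (-1 / ((m : ℝ) + 1)) x).ncard} := by
    ext L
    simp only [mem_preimage, mem_Iio, mem_iInter, mem_ofPred_eq]
    rw [label_lt_iff L x hj]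
    constructor
    · intro h m
      refine h.trans_le ?_
      have hm : -1 / ((m : ℝ) + 1) < 0 := div_neg_of_neg_of_pos (by norm_num) (by positivity)
      have hsub : Ico 0 x ⊆ Ioo (-1 / ((m : ℝ) + 1)) x := fun y hy => ⟨hm.trans_le hy.1, hy.2⟩
      exact_mod_cast ncard_le_ncard (inter_subset_inter_right _ hsub) ((L.isPointSet.finite_inter_Icc _ _).subset
          (inter_subset_inter_right _ Ioo_subset_Icc_self))
    · intro h
      have hneg := L.isLabeling_label.neg_one_neg
      obtain ⟨m, hm⟩ := exists_nat_one_div_lt (neg_pos.2 hneg)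
      refine (h m).trans_le ?_
      refine Nat.cast_le.2 (ncard_le_ncard ?_ ((L.isPointSet.finite_inter_Icc 0 x).subset
        (inter_subset_inter_right _ Ico_subset_Icc_self)))
      rintro y ⟨hy, hy1, hy2⟩
      refine ⟨hy, ?_, hy2⟩
      obtain ⟨i, rfl⟩ := (mem_carrier_iff L _).1 hy
      rw [label_nonneg_iff]
      by_contra! hi
      have := L.isLabeling_label.strictMono.monotone (show i ≤ -1 by omega)
      have h3 : -1 / ((m : ℝ) + 1) = -(1 / ((m : ℝ) + 1)) := by ring
      linarith
  rw [this]
  refine MeasurableSet.iInter fun m => ?_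
  have h := measurable_ncard_inter_Ioo (-1 / ((m : ℝ) + 1)) x
  exact h (MeasurableSet.of_discrete (s := {k : ℕ | j < (k : ℤ)}))

end PointSetMeasurability

/-! ### Measurable dependence of the number of zeros on a parameter -/

section ZeroCount

variable {X : Type*} [TopologicalSpace X] {f : X → ℝ → ℂ}

/-- Projection along a compact factor is a closed map. -/
theorem isClosed_exists_zero (hf : Continuous (Function.uncurry f)) (a b : ℝ) :
    IsClosed {x | ∃ z ∈ Icc a b, f x z = 0} := by
  have h : {x | ∃ z ∈ Icc a b, f x z = 0} =
      Prod.fst '' ({q : X × Icc a b | f q.1 q.2 = 0}) := by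
    ext x
    constructor
    · rintro ⟨z, hz, h0⟩
      exact ⟨(x, ⟨z, hz⟩), h0, rfl⟩
    · rintro ⟨⟨x, z⟩, h0, rfl⟩
      exact ⟨z, z.2, h0⟩
  rw [h]
  refine isClosedMap_fst_of_compactSpace _ (isClosed_eq ?_ continuous_const)
  exact hf.comp (by fun_prop : Continuous fun q : X × Icc a b => (q.1, (q.2 : ℝ)))

theorem exists_rat_Icc_separation {k : ℕ} {a b : ℝ} {z : Fin k → ℝ} (hz : Function.Injective z)
    (hmem : ∀ i, z i ∈ Ioo a b) :
    ∃ q : Fin k → ℚ × ℚ, Pairwise (fun i j => Disjoint (Icc ((q i).1 : ℝ) (q i).2)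
      (Icc ((q j).1 : ℝ) (q j).2)) ∧
      ∀ i, Icc ((q i).1 : ℝ) (q i).2 ⊆ Ioo a b ∧ z i ∈ Icc ((q i).1 : ℝ) (q i).2 := by
  obtain ⟨U, hU, hd⟩ := (finite_range z).t2_separation
  have hq : ∀ i, ∃ q : ℚ × ℚ, Icc (q.1 : ℝ) q.2 ⊆ U (z i) ∩ Ioo a b ∧
      z i ∈ Icc (q.1 : ℝ) q.2 := by
    intro i
    have hn : U (z i) ∩ Ioo a b ∈ 𝓝 (z i) :=
      inter_mem ((hU (z i)).2.mem_nhds (hU (z i)).1) (Ioo_mem_nhds (hmem i).1 (hmem i).2)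
    obtain ⟨l, r, hlr, hsub⟩ := mem_nhds_iff_exists_Ioo_subset.1 hn
    obtain ⟨q1, h1, h1'⟩ := exists_rat_btwn hlr.1
    obtain ⟨q2, h2, h2'⟩ := exists_rat_btwn hlr.2
    exact ⟨(q1, q2), fun y hy => hsub ⟨h1.trans_le hy.1, hy.2.trans_lt h2'⟩, h1'.le, h2.le⟩
  choose q hq using hq
  refine ⟨q, fun i j hij => ?_, fun i => ⟨fun y hy => ((hq i).1 hy).2, (hq i).2⟩⟩
  exact (hd (mem_range_self i) (mem_range_self j) (hz.ne hij)).mono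
    (fun y hy => ((hq i).1 hy).1) (fun y hy => ((hq j).1 hy).1)

/-- The number of zeros in an open interval depends measurably on the parameter. -/
theorem measurable_ncard_zeros [MeasurableSpace X] [BorelSpace X]
    (hf : Continuous (Function.uncurry f)) (a b : ℝ)
    (hfin : ∀ x, ({z | f x z = 0} ∩ Ioo a b).Finite) :
    Measurable fun x => ({z | f x z = 0} ∩ Ioo a b).ncard := by
  refine measurable_of_Ici fun k => ?_
  -- There are at least k zeros exactly when k disjoint closed rational intervals inside (a, b) each
  -- contain one: a countable union of finite intersections of closed sets.
  have : (fun x => ({z | f x z = 0} ∩ Ioo a b).ncard) ⁻¹' Ici k =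
      ⋃ q ∈ {q : Fin k → ℚ × ℚ | Pairwise (fun i j => Disjoint (Icc ((q i).1 : ℝ) (q i).2)
        (Icc ((q j).1 : ℝ) (q j).2)) ∧ ∀ i, Icc ((q i).1 : ℝ) (q i).2 ⊆ Ioo a b},
        ⋂ i, {x | ∃ z ∈ Icc ((q i).1 : ℝ) (q i).2, f x z = 0} := by
    ext x
    simp only [mem_preimage, mem_Ici, mem_iUnion, mem_ofPred_eq, mem_iInter, exists_prop]
    constructor
    · intro hk
      obtain ⟨t, ht, htk⟩ := exists_subset_card_eq hk
      have htfin : t.Finite := (hfin x).subset ht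
      have _ := htfin.fintype
      have e : Fin k ≃ t := (Fintype.equivFinOfCardEq (by
        rw [← Nat.card_eq_fintype_card, Nat.card_coe_set_eq, htk])).symm
      obtain ⟨q, hq1, hq2⟩ := exists_rat_Icc_separation (z := fun i => (e i : ℝ))
        (Subtype.val_injective.comp e.injective) (fun i => (ht (e i).2).2)
      exact ⟨q, ⟨hq1, fun i => (hq2 i).1⟩, fun i => ⟨e i, (hq2 i).2, (ht (e i).2).1⟩⟩
    · rintro ⟨q, ⟨hq1, hq2⟩, hq3⟩
      choose z hz hz0 using hq3
      have hinj : Function.Injective z := by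
        intro i j hij
        by_contra hne
        exact Set.disjoint_left.1 (hq1 hne) (hz i) (hij ▸ hz j)
      have hsub : range z ⊆ {z | f x z = 0} ∩ Ioo a b := by
        rintro _ ⟨i, rfl⟩
        exact ⟨hz0 i, hq2 i (hz i)⟩
      have h1 := ncard_le_ncard hsub (hfin x)
      rwa [← image_univ, ncard_image_of_injective _ hinj, ncard_univ, Nat.card_fin] at h1
  rw [this]
  refine MeasurableSet.biUnion (to_countable _) fun q _ => MeasurableSet.iInter fun i => ?_
  exact (isClosed_exists_zero hf _ _).measurableSet

end ZeroCount

/-! ### The measurable map from coefficients to point sets -/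

section Lift

variable {n : ℕ}

/-- A finite list of coefficients, extended by zero. -/
def extendZero (α : Fin n → ℂ) (k : ℕ) : ℂ := if h : k < n then α ⟨k, h⟩ else 0

theorem continuous_szego (k : ℕ) : Continuous (fun q : (Fin n → ℂ) × ℝ =>
    szego (extendZero q.1) (Circle.exp (q.2 / n)) (1, 1) k) := by
  have hα : ∀ k, Continuous fun q : (Fin n → ℂ) × ℝ => extendZero q.1 k := by
    intro k
    unfold extendZero
    split_ifs with h
    · exact (continuous_apply _).comp continuous_fst
    · exact continuous_const
  have hw : Continuous fun q : (Fin n → ℂ) × ℝ => (Circle.exp (q.2 / n) : ℂ) := by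
    simp only [Circle.coe_exp]
    fun_prop
  induction k with
  | zero => exact continuous_const
  | succ k ih =>
    refine Continuous.prodMk ?_ ?_
    · exact (hw.mul ih.fst).sub ((Complex.continuous_conj.comp (hα k)).mul ih.snd)
    · exact ih.snd.sub (((hα k).mul hw).mul ih.fst)

/-- The lift to the line of the zeros on the circle of the polynomial of degree `n` with
coefficients `α` in the Szegő recursion. -/
def zeroSet (n : ℕ) (α : Fin n → ℂ) : Set ℝ :=
  {x | (szego (extendZero α) (Circle.exp (x / n)) (1, 1) n).1 = 0}

theorem zeroSet_periodic (hn : 1 ≤ n) (α : Fin n → ℂ) (x : ℝ) :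
    x + 2 * Real.pi * n ∈ zeroSet n α ↔ x ∈ zeroSet n α := by
  have hn' : (n : ℝ) ≠ 0 := by positivity
  have : (x + 2 * Real.pi * n) / n = x / n + 2 * Real.pi := by field_simp
  simp only [zeroSet, mem_ofPred_eq, this, Circle.periodic_exp _]

theorem zeroSet_finite (hn : 1 ≤ n) (α : Fin n → ℂ) :
    (zeroSet n α ∩ Ico 0 (2 * Real.pi * n)).Finite := by
  have hn' : (0 : ℝ) < n := by positivity
  have hm := (szegoPoly_monic (extendZero α) n).1
  refine Finite.of_finite_image (f := fun x : ℝ => (Circle.exp (x / n) : ℂ))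
    (((szegoPoly (extendZero α) n).1.rootSet_finite ℂ).subset ?_) ?_
  · rintro _ ⟨x, ⟨hx, -⟩, rfl⟩
    rw [Polynomial.mem_rootSet]
    refine ⟨hm.ne_zero, ?_⟩
    rw [Polynomial.coe_aeval_eq_eval, (eval_szegoPoly _ _ _).1]
    exact hx
  · rintro x ⟨-, hx⟩ y ⟨-, hy⟩ hxy
    have h : x / n = y / n := by
      refine Circle.exp_injOn_Ico (a := 0) (b := 2 * Real.pi) (by simp) ?_ ?_ (Circle.ext hxy)
      · exact ⟨div_nonneg hx.1 hn'.le, by rw [div_lt_iff₀ hn']; exact hx.2⟩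
      · exact ⟨div_nonneg hy.1 hn'.le, by rw [div_lt_iff₀ hn']; exact hy.2⟩
    rwa [div_left_inj' hn'.ne'] at h

/-- By periodicity and finiteness per period, the only obstruction is emptiness: for general α the
polynomial may have no zero on the circle. Stated on a compact interval, the condition is closed in
α. -/
theorem isPointSet_zeroSet_iff (hn : 1 ≤ n) (α : Fin n → ℂ) :
    IsPointSet (zeroSet n α) ↔ ∃ x ∈ Icc 0 (2 * Real.pi * n),
      (szego (extendZero α) (Circle.exp (x / n)) (1, 1) n).1 = 0 := by
  have hn' : (0 : ℝ) < n := by positivity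
  have hp : 0 < 2 * Real.pi * n := by positivity
  constructor
  · intro h
    obtain ⟨y, hy⟩ : (zeroSet n α).Nonempty := by
      by_contra! H
      exact h.not_bddAbove (H ▸ bddAbove_empty)
    refine ⟨toIcoMod hp 0 y, ?_, ?_⟩
    · have := toIcoMod_mem_Ico hp 0 y
      rw [zero_add] at this
      exact Ico_subset_Icc_self this
    · have := (mem_add_int_mul_iff (zeroSet_periodic hn α) y (-toIcoDiv hp 0 y)).2 hy
      have e : toIcoMod hp 0 y = y + (-toIcoDiv hp 0 y : ℤ) * (2 * Real.pi * n) := by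
        rw [toIcoMod, zsmul_eq_mul]; push_cast; ring
      rw [e]
      exact this
  · rintro ⟨x, -, hx⟩
    exact isPointSet_of_periodic (zeroSet_periodic hn α) hp (zeroSet_finite hn α) hx

theorem measurableSet_isPointSet_zeroSet (hn : 1 ≤ n) :
    MeasurableSet {α : Fin n → ℂ | IsPointSet (zeroSet n α)} := by
  have hf : Continuous (Function.uncurry fun (α : Fin n → ℂ) (x : ℝ) =>
      (szego (extendZero α) (Circle.exp (x / n)) (1, 1) n).1) := (continuous_szego n).fst
  simp only [isPointSet_zeroSet_iff hn]
  exact (isClosed_exists_zero hf _ _).measurableSet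

open Classical in
/-- The point set `zeroSet n α`, with a default value `D` if it is not a point set. -/
noncomputable def zeroPointSet (n : ℕ) (D : PointSet) (α : Fin n → ℂ) : PointSet :=
  if H : IsPointSet (zeroSet n α) then ⟨_, H⟩ else D

theorem measurable_zeroPointSet (hn : 1 ≤ n) (D : PointSet) : Measurable (zeroPointSet n D) := by
  classical
  have hp : 0 < 2 * Real.pi * n := by positivity
  have hf : Continuous (Function.uncurry fun (α : Fin n → ℂ) (x : ℝ) =>
      (szego (extendZero α) (Circle.exp (x / n)) (1, 1) n).1) := (continuous_szego n).fst
  have hG := measurableSet_isPointSet_zeroSet hn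
  refine measurable_pointSet fun a b => ?_
  have h1 := measurable_ncard_zeros hf a b fun α =>
    (finite_inter_Icc_of_periodic (zeroSet_periodic hn α) hp (zeroSet_finite hn α) a b).subset
      (inter_subset_inter_right _ Ioo_subset_Icc_self)
  have h2 : (fun α => ((zeroPointSet n D α).carrier ∩ Ioo a b).ncard) = fun α =>
      if IsPointSet (zeroSet n α) then (zeroSet n α ∩ Ioo a b).ncard
        else (D.carrier ∩ Ioo a b).ncard := by
    funext α
    unfold zeroPointSet
    split_ifs <;> rfl
  rw [h2]
  exact Measurable.ite hG h1 measurable_const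

/-- The Verblunsky coefficients of `(1 / 2n) ∑ g_i δ_{u_i}`, with `u_i` the points of the circle
defined by `L`. -/
noncomputable def pointVerblunsky (n : ℕ) (q : PointSet × (Fin n → ℝ)) (k : Fin n) : ℂ :=
  atomVerblunsky (fun i => (circlePoint n q.1 i : ℂ)) (fun i => q.2 i / (2 * n)) k

theorem measurable_atomValues {X : Type*} [MeasurableSpace X] {u : X → Fin n → ℂ}
    {s : X → Fin n → ℝ} (hu : Measurable u) (hs : Measurable s) (k : ℕ) :
    (Measurable fun x => atomValues (u x) (s x) k) ∧
      Measurable fun x => atomVerblunsky (u x) (s x) k := by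
  have hu' : ∀ i, Measurable fun x => u x i := fun i => (measurable_pi_apply i).comp hu
  have hs' : ∀ i, Measurable fun x => (s x i : ℂ) := fun i =>
    Complex.measurable_ofReal.comp ((measurable_pi_apply i).comp hs)
  have step : ∀ k, (Measurable fun x => atomValues (u x) (s x) k) →
      Measurable fun x => atomVerblunsky (u x) (s x) k := by
    intro k h
    have h1 : ∀ i, Measurable fun x => atomValues (u x) (s x) k i :=
      fun i => (measurable_pi_apply i).comp h
    refine Complex.continuous_conj.measurable.comp (Measurable.div ?_ ?_)
    · exact Finset.measurable_sum _ fun i _ => (hs' i).mul ((hu' i).mul (h1 i).fst)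
    · exact Finset.measurable_sum _ fun i _ => (hs' i).mul (h1 i).snd
  have main : Measurable fun x => atomValues (u x) (s x) k := by
    induction k with
    | zero => exact measurable_const
    | succ k ih =>
      have h1 : ∀ i, Measurable fun x => atomValues (u x) (s x) k i :=
        fun i => (measurable_pi_apply i).comp ih
      refine measurable_pi_lambda _ fun i => Measurable.prodMk ?_ ?_
      · exact ((hu' i).mul (h1 i).fst).sub
          ((Complex.continuous_conj.measurable.comp (step k ih)).mul (h1 i).snd)
      · exact (h1 i).snd.sub (((step k ih).mul (hu' i)).mul (h1 i).fst)
  exact ⟨main, step k main⟩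

theorem measurable_pointVerblunsky (n : ℕ) : Measurable (pointVerblunsky n) := by
  refine measurable_pi_lambda _ fun k => (measurable_atomValues ?_ ?_ k).2
  · refine measurable_pi_lambda _ fun i => ?_
    simp only [circlePoint, Circle.coe_exp]
    have h : Measurable fun q : PointSet × (Fin n → ℝ) => q.1.label (i : ℤ) :=
      (measurable_label (by omega)).comp measurable_fst
    fun_prop
  · exact measurable_pi_lambda _ fun i =>
      ((measurable_pi_apply i).comp measurable_snd).div_const _

end Lift

/-! ### Equality of laws and invariance -/

section Law

variable {n : ℕ}

theorem PointSet.eq_of_carrier_eq {L L' : PointSet} (h : L.carrier = L'.carrier) : L = L' := by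
  cases L; cases L'; congr

theorem verblunsky_circleMeasure {L : PointSet} (hL : L.IsPeriodic n) {γ : ℤ → ℝ}
    (hpos : ∀ j, 0 < γ j) (k : Fin n) :
    verblunsky (circleMeasure n L γ) k =
      pointVerblunsky n (L, fun i => γ ((i : ℤ) + 1)) k := by
  have hn : (0 : ℝ) < n := by exact_mod_cast k.pos
  exact verblunsky_eq (circlePoint_injective hL) (s := fun i : Fin n => γ ((i : ℤ) + 1) / (2 * n))
    (fun i => div_pos (hpos _) (by positivity)) (by rw [Fintype.card_fin]; exact k.2)

theorem zeroSet_pointVerblunsky (hn : 1 ≤ n) {L : PointSet} (hL : L.IsPeriodic n) {g : Fin n → ℝ}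
    (hg : ∀ i, 0 < g i) : zeroSet n (pointVerblunsky n (L, g)) = L.carrier := by
  ext x
  rw [mem_carrier_iff_szego hn hL (s := fun i => g i / (2 * n))
    (fun i => div_pos (hg i) (by positivity)), zeroSet, mem_ofPred_eq,
    szego_congr fun k hk => ?_]
  rw [extendZero, dif_pos hk]
  rfl

theorem levelSet_eq_zeroSet (hn : 1 ≤ n) {L : PointSet} (hL : L.IsPeriodic n) {γ : ℤ → ℝ}
    (hpos : ∀ j, 0 < γ j) (hγ : ∀ j : ℤ, γ (j + n) = γ j)
    (hsum : ∑ i : Fin n, γ (i : ℤ) = 2 * (n : ℝ)) (h : ℝ) :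
    levelSet L γ h =
      zeroSet n fun k => pointVerblunsky n (L, fun i => γ (i : ℤ)) k * rotation h := by
  ext x
  rw [mem_levelSet_iff hn hL hpos hγ hsum, zeroSet, mem_ofPred_eq, szego_congr fun k hk => ?_]
  rw [extendZero, dif_pos hk]
  rfl

theorem zeroPointSet_eq (D : PointSet) {α : Fin n → ℂ} (h : IsPointSet (zeroSet n α)) :
    zeroPointSet n D α = ⟨zeroSet n α, h⟩ := dif_pos h

theorem exists_circle_eq_rotation (h : ℝ) : ∃ u : Circle, (u : ℂ) = rotation h := by
  have h1 := conj_rotation_mul h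
  rw [← Complex.normSq_eq_conj_mul_self] at h1
  have h2 : Complex.normSq (rotation h) = 1 := by exact_mod_cast h1
  rw [Complex.normSq_eq_norm_sq, pow_eq_one_iff_of_nonneg (norm_nonneg _) two_ne_zero] at h2
  exact ⟨⟨rotation h, mem_sphere_zero_iff_norm.2 h2⟩, rfl⟩

theorem measurable_rotation : Measurable rotation := by
  unfold rotation
  fun_prop

/-- Rotating a rotation-invariant law by an independent random angle does not change it. -/
theorem map_mul_rotation {ν : Measure (Fin n → ℂ)} [IsProbabilityMeasure ν]
    (hν : ∀ u : Circle, ν.map (fun v k => v k * (u : ℂ)) = ν)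
    (ρ : Measure ℝ) [IsProbabilityMeasure ρ] :
    (ν.prod ρ).map (fun q (k : Fin n) => q.1 k * rotation q.2) = ν := by
  have hR : Measurable fun (q : (Fin n → ℂ) × ℝ) (k : Fin n) => q.1 k * rotation q.2 :=
    measurable_pi_lambda _ fun k => ((measurable_pi_apply k).comp measurable_fst).mul
      (measurable_rotation.comp measurable_snd)
  ext S hS
  rw [Measure.map_apply hR hS, Measure.prod_apply_symm (hR hS)]
  -- For fixed h the factor is a fixed point of the circle, so the section has measure ν S;
  -- integrating over h concludes.
  have : ∀ h : ℝ, ν ((fun v => (v, h)) ⁻¹'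
      ((fun (q : (Fin n → ℂ) × ℝ) (k : Fin n) => q.1 k * rotation q.2) ⁻¹' S)) = ν S := by
    intro h
    obtain ⟨u, hu⟩ := exists_circle_eq_rotation h
    conv_rhs => rw [← hν u, Measure.map_apply (by fun_prop) hS, hu]
    rfl
  simp [this]

theorem finRotate_val_eq {γ : ℤ → ℝ} (hγ : ∀ j : ℤ, γ (j + n) = γ j) (i : Fin n) :
    γ (finRotate n i : ℤ) = γ ((i : ℤ) + 1) := by
  rcases n with _ | m
  · exact i.elim0
  · rw [coe_finRotate]
    split_ifs with h
    · have := hγ 0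
      rw [h, Fin.val_last]
      push_cast at this ⊢
      rw [← this]
      ring_nf
    · push_cast
      rfl

variable {P : Measure (Weights × ℝ)}

theorem measurable_weights (f : Fin n → ℤ) :
    Measurable fun (g : Weights × ℝ) (i : Fin n) => g.1.1 (f i) :=
  measurable_pi_lambda _ fun i =>
    (measurable_pi_apply (f i)).comp (measurable_subtype_coe.comp measurable_fst)

/-- For an n-periodic sequence, shifting the index by one permutes (γ_0, …, γ_{n-1}) cyclically. -/
theorem map_shift_eq
    (hper : ∀ᵐ g ∂P, (∀ j : ℤ, g.1.1 (j + n) = g.1.1 j) ∧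
      ∑ i : Fin n, g.1.1 (i : ℤ) = 2 * (n : ℝ))
    (hexch : ∀ τ : Equiv.Perm (Fin n),
      P.map (fun g (i : Fin n) => g.1.1 (τ i : ℤ)) =
        P.map (fun g (i : Fin n) => g.1.1 (i : ℤ))) :
    P.map (fun g (i : Fin n) => g.1.1 ((i : ℤ) + 1)) =
      P.map (fun g (i : Fin n) => g.1.1 (i : ℤ)) := by
  rw [← hexch (finRotate n)]
  refine Measure.map_congr ?_
  filter_upwards [hper] with g hg
  funext i
  exact (finRotate_val_eq hg.1 i).symm

theorem isInvariantLaw_of_rotation [IsProbabilityMeasure P] (hn : 1 ≤ n)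
    (hper : ∀ᵐ g ∂P, (∀ j : ℤ, g.1.1 (j + n) = g.1.1 j) ∧
      ∑ i : Fin n, g.1.1 (i : ℤ) = 2 * (n : ℝ))
    (hexch : ∀ τ : Equiv.Perm (Fin n),
      P.map (fun g (i : Fin n) => g.1.1 (τ i : ℤ)) =
        P.map (fun g (i : Fin n) => g.1.1 (i : ℤ)))
    (hindep : IndepFun (fun g : Weights × ℝ => g.1) (fun g : Weights × ℝ => g.2) P)
    {Q : Measure PointSet} [IsProbabilityMeasure Q] (hQ : ∀ᵐ L ∂Q, L.IsPeriodic n)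
    (hrot : ∀ u : Circle, IdentDistrib
      (fun p (k : Fin n) => verblunsky (circleMeasure n p.1 p.2.1.1) k * (u : ℂ))
      (fun p (k : Fin n) => verblunsky (circleMeasure n p.1 p.2.1.1) k)
      (Q.prod P) (Q.prod P)) :
    IsInvariantLaw P Q := by
  -- `D` is only a default value for coefficients without zeros on the circle; almost surely it is
  -- not used.
  obtain ⟨D⟩ := nonempty_of_isProbabilityMeasure Q
  have hL : ∀ᵐ p ∂(Q.prod P), p.1.IsPeriodic n := Measure.quasiMeasurePreserving_fst.ae hQ
  have hγ := Measure.quasiMeasurePreserving_snd (μ := Q) |>.ae hper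
  set r : Weights × ℝ → Fin n → ℝ := fun g i => g.1.1 (i : ℤ) with hr
  have hrm : Measurable r := measurable_weights _
  set r' : Weights × ℝ → Fin n → ℝ := fun g i => g.1.1 ((i : ℤ) + 1) with hr'
  have hrm' : Measurable r' := measurable_weights _
  have hV := measurable_pointVerblunsky n
  -- `ν` uses the weights γ_i of the Stieltjes transform; the rotation hypothesis concerns those of
  -- σ, namely γ_{i+1}. The two laws are identified in `hν'`.
  set ν : Measure (Fin n → ℂ) := (Q.prod P).map fun p => pointVerblunsky n (p.1, r p.2) with hν
  have hVr : ∀ {f : Weights × ℝ → Fin n → ℝ}, Measurable f →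
      Measurable fun p : PointSet × (Weights × ℝ) => pointVerblunsky n (p.1, f p.2) :=
    fun hf => hV.comp (measurable_fst.prodMk (hf.comp measurable_snd))
  have hνp : IsProbabilityMeasure ν := Measure.isProbabilityMeasure_map (hVr hrm).aemeasurable
  have hmap : ∀ {f : Weights × ℝ → Fin n → ℝ}, Measurable f →
      ((Q.prod P).map fun p => pointVerblunsky n (p.1, f p.2)) =
        (Q.prod (P.map f)).map (pointVerblunsky n) := by
    intro f hf
    have h := Measure.map_prod_map Q P measurable_id hf
    rw [Measure.map_id] at h
    rw [h, Measure.map_map hV (measurable_id.prodMap hf)]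
    rfl
  have hν' : ((Q.prod P).map fun p => pointVerblunsky n (p.1, r' p.2)) = ν := by
    rw [hν, hmap hrm, hmap hrm', map_shift_eq hper hexch]
  have hae : (fun p (k : Fin n) => verblunsky (circleMeasure n p.1 p.2.1.1) k)
      =ᵐ[Q.prod P] fun p => pointVerblunsky n (p.1, r' p.2) := by
    filter_upwards [hL] with p hp
    funext k
    exact verblunsky_circleMeasure hp p.2.1.2.1 k
  have hνrot : ∀ u : Circle, ν.map (fun v k => v k * (u : ℂ)) = ν := by
    intro u
    have h := (hrot u).map_eq
    have h1 : (fun p (k : Fin n) => verblunsky (circleMeasure n p.1 p.2.1.1) k * (u : ℂ))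
        =ᵐ[Q.prod P] fun p k => pointVerblunsky n (p.1, r' p.2) k * (u : ℂ) := by
      filter_upwards [hae] with p hp
      funext k
      rw [← hp]
    rw [Measure.map_congr hae, Measure.map_congr h1, hν'] at h
    conv_lhs => rw [← hν', Measure.map_map (by fun_prop) (hVr hrm')]
    exact h
  set T : PointSet × (Weights × ℝ) → Fin n → ℂ :=
    fun p k => pointVerblunsky n (p.1, r p.2) k * rotation p.2.2 with hT
  have hTm : Measurable T := measurable_pi_lambda _ fun k =>
    ((measurable_pi_apply k).comp (hVr hrm)).mul
      (measurable_rotation.comp (measurable_snd.comp measurable_snd))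
  have hTν : (Q.prod P).map T = ν := by
    have hsnd : Measurable fun g : Weights × ℝ => g.2 := measurable_snd
    have _ : IsProbabilityMeasure (P.map r) := Measure.isProbabilityMeasure_map hrm.aemeasurable
    have _ : IsProbabilityMeasure (P.map fun g => g.2) :=
      Measure.isProbabilityMeasure_map hsnd.aemeasurable
    have hi : IndepFun r (fun g => g.2) P := hindep.comp
      (φ := fun (w : Weights) (i : Fin n) => w.1 (i : ℤ)) (ψ := id)
      (measurable_pi_lambda _ fun i => (measurable_pi_apply _).comp measurable_subtype_coe)
      measurable_id
    have hprod := (indepFun_iff_map_prod_eq_prod_map_map hrm.aemeasurable hsnd.aemeasurable).1 hi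
    -- L, the weights and h are jointly independent, so the coefficients, functions of (L, γ), are
    -- independent of h.
    have h1 : (Q.prod P).map (fun p => ((p.1, r p.2), p.2.2)) =
        (Q.prod (P.map r)).prod (P.map fun g => g.2) := by
      have h2 := Measure.map_prod_map Q P measurable_id (hrm.prodMk hsnd)
      rw [Measure.map_id, hprod] at h2
      have h3 := ((measurePreserving_prodAssoc Q (P.map r) (P.map fun g => g.2)).symm).map_eq
      rw [← h3, h2, Measure.map_map (MeasurableEquiv.measurable _)
        (measurable_id.prodMap (hrm.prodMk hsnd))]
      rfl
    have h4 : (Q.prod P).map (fun p => (pointVerblunsky n (p.1, r p.2), p.2.2)) =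
        ν.prod (P.map fun g => g.2) := by
      have h5 := Measure.map_prod_map (Q.prod (P.map r)) (P.map fun g => g.2) hV measurable_id
      rw [Measure.map_id, ← hmap hrm, ← h1, Measure.map_map (hV.prodMap measurable_id)
        (by fun_prop)] at h5
      exact h5.symm
    rw [← map_mul_rotation hνrot (P.map fun g => g.2), ← h4, Measure.map_map _
      ((hVr hrm).prodMk (by fun_prop))]
    · rfl
    · exact measurable_pi_lambda _ fun k => ((measurable_pi_apply k).comp measurable_fst).mul
        (measurable_rotation.comp measurable_snd)
  have hE := measurable_zeroPointSet hn D
  have hfst : ∀ᵐ p ∂(Q.prod P), zeroSet n (pointVerblunsky n (p.1, r p.2)) = p.1.carrier := by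
    filter_upwards [hL] with p hp
    exact zeroSet_pointVerblunsky hn hp fun i => p.2.1.2.1 _
  have hG : MeasurableSet {α : Fin n → ℂ | IsPointSet (zeroSet n α)} :=
    measurableSet_isPointSet_zeroSet hn
  -- Under `ν` the zero set is L itself, hence a point set. Since `T` also has law `ν`, the level
  -- set is almost surely a point set, with no interlacing argument.
  have hpsν : ∀ᵐ α ∂ν, IsPointSet (zeroSet n α) := by
    rw [hν, ae_map_iff (hVr hrm).aemeasurable hG]
    filter_upwards [hfst] with p hp
    rw [hp]
    exact p.1.isPointSet
  have hps : ∀ᵐ p ∂(Q.prod P), IsPointSet (zeroSet n (T p)) :=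
    ae_of_ae_map hTm.aemeasurable (by rwa [hTν])
  have hlevel : ∀ᵐ p ∂(Q.prod P), levelSet p.1 p.2.1.1 p.2.2 = zeroSet n (T p) := by
    filter_upwards [hL, hγ] with p hp hp'
    exact levelSet_eq_zeroSet hn hp p.2.1.2.1 hp'.1 hp'.2 _
  have htrans : transition =ᵐ[Q.prod P] fun p => zeroPointSet n D (T p) := by
    filter_upwards [hps, hlevel] with p hp hp'
    rw [zeroPointSet_eq D hp, transition, dif_pos (hp' ▸ hp)]
    exact PointSet.eq_of_carrier_eq hp'
  have hQν : ν.map (zeroPointSet n D) = Q := by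
    rw [hν, Measure.map_map hE (hVr hrm)]
    have : (zeroPointSet n D ∘ fun p => pointVerblunsky n (p.1, r p.2))
        =ᵐ[Q.prod P] Prod.fst := by
      filter_upwards [hfst] with p hp
      have h : IsPointSet (zeroSet n (pointVerblunsky n (p.1, r p.2))) := hp ▸ p.1.isPointSet
      rw [Function.comp_apply, zeroPointSet_eq D h]
      exact PointSet.eq_of_carrier_eq hp
    rw [Measure.map_congr this, Measure.map_fst_prod, measure_univ, one_smul]
  refine ⟨?_, ⟨⟨_, hE.comp hTm, htrans⟩, ?_⟩⟩
  · filter_upwards [hps, hlevel] with p hp hp'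
    rwa [hp']
  · rw [Measure.map_congr htrans, ← Function.comp_def (zeroPointSet n D) T,
      ← Measure.map_map hE hTm, hTν, hQν]

end Law

end StieltjesChain

/-! ### The main theorem -/

theorem mainTheorem7 (n : ℕ) (hn : 1 ≤ n)
    (P : Measure (StieltjesChain.Weights × ℝ)) [IsProbabilityMeasure P]
    (hper : ∀ᵐ g ∂P, (∀ j : ℤ, g.1.1 (j + n) = g.1.1 j) ∧
      ∑ i : Fin n, g.1.1 (i : ℤ) = 2 * (n : ℝ))
    (hexch : ∀ τ : Equiv.Perm (Fin n),
      P.map (fun g (i : Fin n) => g.1.1 (τ i : ℤ)) =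
        P.map (fun g (i : Fin n) => g.1.1 (i : ℤ)))
    (hindep : IndepFun (fun g : StieltjesChain.Weights × ℝ => g.1)
      (fun g : StieltjesChain.Weights × ℝ => g.2) P)
    (Q : Measure StieltjesChain.PointSet) [IsProbabilityMeasure Q]
    (hQ : ∀ᵐ L ∂Q, L.IsPeriodic n) :
    (∀ᵐ L ∂Q,
      (∃ θ : Fin n → ℝ, StrictMono θ ∧
        ∀ i, θ i ∈ Ico 0 (2 * Real.pi) ∧ StieltjesChain.circlePoint n L i = Circle.exp (θ i)) ∧
      L.carrier = {x : ℝ | Circle.exp (x / n) ∈ range (StieltjesChain.circlePoint n L)}) ∧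
    (∀ᵐ p ∂(Q.prod P),
      IsProbabilityMeasure (StieltjesChain.circleMeasure n p.1 p.2.1.1)) ∧
    ((∀ u : Circle,
      IdentDistrib
        (fun p (k : Fin n) =>
          StieltjesChain.verblunsky (StieltjesChain.circleMeasure n p.1 p.2.1.1) k * (u : ℂ))
        (fun p (k : Fin n) =>
          StieltjesChain.verblunsky (StieltjesChain.circleMeasure n p.1 p.2.1.1) k)
        (Q.prod P) (Q.prod P)) →
      StieltjesChain.IsInvariantLaw P Q) := by
  refine ⟨?_, ?_, fun hrot =>
    StieltjesChain.isInvariantLaw_of_rotation hn hper hexch hindep hQ hrot⟩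
  · filter_upwards [hQ] with L hL
    exact ⟨StieltjesChain.exists_strictMono_arg hn hL, StieltjesChain.carrier_eq hn hL⟩
  · filter_upwards [Measure.quasiMeasurePreserving_snd.ae hper] with p hp
    exact StieltjesChain.circleMeasure_isProbabilityMeasure hn p.1 p.2.1.2.1 hp.1 hp.2
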